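/- **Setting.** For $N\ge 1$ let $\Gamma(N)\subseteq SL_2(\mathbb Z)$ be the principal congruence subgroup. For even $K\ge 2$ put $G_K(z)=-\frac{B_K}{2K}+\sum_{n\ge1}\big(\sum_{d\mid n}d^{K-1}\big)e^{2\pi inz}$ on the upper half plane $\mathbb H$. Let $\mathcal M_w$ be the space of functions on $\mathbb H$ that are modular forms of weight $w\ge 0$ for some $\Gamma(N)$, $N\geq 1$. A *quasimodular form* of level $\Gamma(N)$, weight $k\ge0$ and depth $s\ge 0$ is a holomorphic $f:\mathbb H\to\mathbb C$ for which there are holomorphic $f_0,\dots,f_s$ on $\mathbb H$, $f_s\neq0$, holomorphic at the cusps (i.e. for every $j$ and every $\gamma=\begin{pmatrix}a&b\\c&d\end{pmatrix}\in SL_2(\mathbb Z)$ the function $(cz+d)^{-(k-2j)}f_j(\gamma z)$ is bounded as $\operatorname{Im}z\to\infty$), such that $$(cz+d)^{-k}f\Big(\frac{az+b}{cz+d}\Big)=\sum_{j=0}^s f_j(z)\Big(\frac{c}{cz+d}\Big)^j\qquad\text{for all }\begin{pmatrix}a&b\\c&d\end{pmatrix}\in\Gamma(N);$$ the zero function is quasimodular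 of every weight and of depth $0$. Let $\mathcal{QM}$ be the space of all finite sums of quasimodular forms (of all weights, depths and levels $\Gamma(N)$, $N\ge1$). By the structure theorem of Kaneko and Zagier every $f\in\mathcal{QM}$ can be written in exactly one way as a finite sum $f=\sum_{i,w\ge 0}a_{i,w}G_2^i$ with $a_{i,w}\in\mathcal M_w$; put $a_i(f)=\sum_w a_{i,w}$. For $\alpha=\begin{pmatrix}a&b\\c&d\end{pmatrix}\in GL_2^+(\mathbb Q)$ let $(g|_w\alpha)(z)=(cz+d)^{-w}g\big(\frac{az+b}{cz+d}\big)$ and $f\|\alpha=\sum_{i,w}(a_{i,w}|_w\alpha)\,G_2^i$. Let $\Gamma=\Gamma(N)$. The space $\mathcal Q(\Gamma)$ of quasimodular Hecke operators of level $\Gamma$ consists of the functions of finite support $F:\Gamma\backslash GL_2^+(\mathbb Q)\to\mathcal{QM}$, $\Gamma\alpha\mapsto F_\alpha$, with $F_{\alpha\gamma}=F_\alpha\|\gamma$ for all $\alpha\in GL_2^+(\mathbb Q)$, $\gamma\in\Gamma$. On $\mathcal{QM}$ define, for $k\ge1$ and $l\ge0$, $$D(f)=-\frac1{8\pi i}\sum_i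 i\,a_i(f)\,G_2^{i-1}G_2',\qquad T_k^l(f)=G_4^l\sum_i i\,a_i(f)\,G_2^{i+k-2},$$ and for $m\ge1$, $\alpha\in GL_2^+(\mathbb Q)$ put $\nu_\alpha^{(m)}=-\frac5{24}\big(G_4^m|_{4m}\alpha-G_4^m\big)$. **Theorem.** Let $\mathcal L$ be the complex Lie algebra generated by the symbols $D$, $T_k^l$ ($k\ge1$, $l\ge0$) and $\phi^{(m)}$ ($m\ge1$) subject to the relations $$[T_k^l,T_{k'}^{l'}]=(k'-k)T_{k+k'-2}^{l+l'},\qquad [D,\phi^{(m)}]=[T_k^l,\phi^{(m)}]=[\phi^{(m)},\phi^{(m')}]=0,$$ $$[T_k^l,D]=\tfrac5{24}(k-1)T_{k-1}^{l+1}-\tfrac12(k-3)T_{k+1}^l$$ (terms with coefficient $0$, in which $T_0^l$ may occur, are read as $0$). Then, for every $N\ge1$ and $\Gamma=\Gamma(N)$, the Lie algebra $\mathcal L$ acts on $\mathcal Q(\Gamma)$ through the operators above: there is a homomorphism of complex Lie algebras $\rho:\mathcal L\to\operatorname{End}_{\mathbb C}(\mathcal Q(\Gamma))$ with $$(\rho(D)F)_\alpha=D(F_\alpha),\qquad(\rho(T_k^l)F)_\alpha=T_k^l(F_\alpha),\qquad(\rho(\phi^{(m)})F)_\alpha=\nu_\alpha^{(m)}\cdot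 F_\alpha$$ for all $F\in\mathcal Q(\Gamma)$ and $\alpha\in GL_2^+(\mathbb Q)$. (In particular these formulas define operators on $\mathcal Q(\Gamma)$.) -/

import Mathlib

open UpperHalfPlane
open scoped MatrixGroups ModularForm Manifold

-- The ring of linear endomorphisms of a vector space is a Lie ring under the commutator.
attribute [local instance] LieRing.ofAssociativeRing

namespace QuasimodularHecke

noncomputable section

/-! ### Eisenstein series -/

/-- The Eisenstein series `G_K(z) = -B_K/(2K) + ∑_{n ≥ 1} σ_{K-1}(n) exp(2πinz)`
(used for even `K ≥ 2`). -/
def eisG (K : ℕ) (z : ℍ) : ℂ :=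
  -((bernoulli K : ℚ) : ℂ) / (2 * (K : ℂ)) +
    ∑' n : ℕ+, (ArithmeticFunction.sigma (K - 1) (n : ℕ) : ℂ) *
      Complex.exp (2 * (Real.pi : ℂ) * Complex.I * (n : ℂ) * (z : ℂ))

/-- The weight two Eisenstein series `G₂`. -/
def G2 : ℍ → ℂ := eisG 2

/-- The weight four Eisenstein series `G₄`. -/
def G4 : ℍ → ℂ := eisG 4

/-- The complex derivative `G₂'` of `G₂`. -/
def G2' (z : ℍ) : ℂ := deriv (G2 ∘ ofComplex) (z : ℂ)

/-! ### Modular and quasimodular forms -/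

/-- `Γ(N)` as a subgroup of `GL₂(ℝ)`. -/
abbrev levelR (N : ℕ) : Subgroup (GL (Fin 2) ℝ) :=
  (CongruenceSubgroup.Gamma N).map (Matrix.SpecialLinearGroup.mapGL ℝ)

/-- `f : ℍ → ℂ` is a modular form of weight `w` and level `Γ(N)`. -/
def IsModularForm (N w : ℕ) (f : ℍ → ℂ) : Prop :=
  ∃ g : ModularForm (levelR N) (w : ℤ), (g : ℍ → ℂ) = f

theorem levelR_mono {N N' : ℕ} (h : N ∣ N') : levelR N' ≤ levelR N := by
  apply Subgroup.map_mono
  intro γ hγ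
  rw [CongruenceSubgroup.Gamma_mem] at hγ ⊢
  have key : ∀ a b : ℤ, (a : ZMod N') = (b : ZMod N') → (a : ZMod N) = (b : ZMod N) := by
    intro a b hab
    rw [ZMod.intCast_eq_intCast_iff_dvd_sub] at hab ⊢
    exact (Int.natCast_dvd_natCast.mpr h).trans hab
  obtain ⟨h1, h2, h3, h4⟩ := hγ
  refine ⟨?_, ?_, ?_, ?_⟩
  · simpa using key _ 1 (by simpa using h1)
  · simpa using key _ 0 (by simpa using h2)
  · simpa using key _ 0 (by simpa using h3)
  · simpa using key _ 1 (by simpa using h4)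

theorem IsModularForm.mono {N N' w : ℕ} (h : N ∣ N') {f : ℍ → ℂ}
    (hf : IsModularForm N w f) : IsModularForm N' w f := by
  obtain ⟨g, rfl⟩ := hf
  exact ⟨{ toFun := g
           slash_action_eq' := fun γ hγ => g.slash_action_eq' γ (levelR_mono h hγ)
           holo' := g.holo'
           bdd_at_cusps' := fun hc => g.bdd_at_cusps' (hc.mono (levelR_mono h)) }, rfl⟩

/-- The weight `w` part of the modular tower: the functions that are modular forms of weight `w`
and of some level `Γ(N)`, `N ≥ 1`. -/
def modularTower (w : ℕ) : Submodule ℂ (ℍ → ℂ) where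
  carrier := {f | ∃ N : ℕ, 1 ≤ N ∧ IsModularForm N w f}
  zero_mem' := ⟨1, le_rfl, 0, rfl⟩
  add_mem' := by
    rintro f g ⟨N, hN, hf⟩ ⟨N', hN', hg⟩
    obtain ⟨f', rfl⟩ := hf.mono (Dvd.intro N' rfl)
    obtain ⟨g', rfl⟩ := hg.mono (Dvd.intro_left N rfl)
    exact ⟨N * N', Nat.mul_pos hN hN', f' + g', rfl⟩
  smul_mem' := by
    rintro c f ⟨N, hN, f', rfl⟩
    exact ⟨N, hN, c • f', rfl⟩

/-- `f` is a quasimodular form of level `Γ(N)`, weight `k` and depth `s`: a holomorphic function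
with holomorphic `f_0, …, f_s`, `f_s ≠ 0`, such that
`(cz+d)^{-k} f((az+b)/(cz+d)) = ∑_{j ≤ s} f_j(z) (c/(cz+d))^j` on `Γ(N)`.  As usual the `f_j`
are required to be holomorphic at the cusps, i.e. each `f_j |_{k-2j} γ`, `γ ∈ SL₂(ℤ)`, is bounded
as `Im z → ∞` (note `f = f_0`).  By convention the zero function has depth `0`. -/
def IsQuasimodularForm (N k s : ℕ) (f : ℍ → ℂ) : Prop :=
  (f = 0 ∧ s = 0) ∨
  (MDifferentiable 𝓘(ℂ) 𝓘(ℂ) f ∧ ∃ φ : ℕ → ℍ → ℂ,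
    (∀ j ≤ s, MDifferentiable 𝓘(ℂ) 𝓘(ℂ) (φ j)) ∧
    (∀ j ≤ s, ∀ γ : SL(2, ℤ), IsBoundedAtImInfty (φ j ∣[(k : ℤ) - 2 * (j : ℤ)] γ)) ∧
    φ s ≠ 0 ∧
    ∀ γ ∈ CongruenceSubgroup.Gamma N, ∀ z : ℍ,
      (((γ 1 0 : ℤ) : ℂ) * (z : ℂ) + ((γ 1 1 : ℤ) : ℂ)) ^ (-(k : ℤ)) * f (γ • z) =
        ∑ j ∈ Finset.range (s + 1),
          φ j z * (((γ 1 0 : ℤ) : ℂ) / (((γ 1 0 : ℤ) : ℂ) * (z : ℂ) + ((γ 1 1 : ℤ) : ℂ))) ^ j)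

/-- The quasimodular tower `QM`: sums of quasimodular forms of arbitrary weight, depth and level
`Γ(N)`, `N ≥ 1`. -/
def QM : Submodule ℂ (ℍ → ℂ) :=
  Submodule.span ℂ {f | ∃ N k s : ℕ, 1 ≤ N ∧ IsQuasimodularForm N k s f}

/-! ### The expansion of a quasimodular form in powers of `G₂` -/

/-- Families of modular coefficients `a_{i,w}`, almost all zero, with `a_{i,w}` of weight `w`. -/
abbrev Coeffs : Type := DirectSum (ℕ × ℕ) fun p => modularTower p.2

/-- `∑_{i,w} L_{i,w}(a_{i,w})`, for linear maps `L_{i,w}` on functions. -/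
def sumCoeffs (L : ℕ → ℕ → (ℍ → ℂ) →ₗ[ℂ] (ℍ → ℂ)) : Coeffs →ₗ[ℂ] (ℍ → ℂ) :=
  DirectSum.toModule ℂ (ℕ × ℕ) (ℍ → ℂ) fun p => L p.1 p.2 ∘ₗ (modularTower p.2).subtype

/-- `(a_{i,w}) ↦ ∑_{i,w} a_{i,w} G₂^i`. -/
def polyG2 : Coeffs →ₗ[ℂ] (ℍ → ℂ) :=
  sumCoeffs fun i _ => LinearMap.mulRight ℂ (G2 ^ i)

/-- The modular coefficients of `f = ∑_i a_i(f) G₂^i`, `a_i(f) = ∑_w a_{i,w}`.  By the structure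
theorem of Kaneko and Zagier every quasimodular form is such a polynomial in `G₂`, in exactly one
way: `polyG2` is injective with range `QM`, and `coeffs` restricted to `QM` is its inverse.
(It is applied to elements of `QM` only; linearity is built in.) -/
def coeffs : (ℍ → ℂ) →ₗ[ℂ] Coeffs :=
  LinearMap.leftInverse (K := ℂ) (V := Coeffs) (V' := ℍ → ℂ) polyG2

/-! ### Slash operators -/

/-- The group `GL₂⁺(ℚ)`. -/
abbrev GQ : Type := Matrix.GLPos (Fin 2) ℚ

/-- `α ∈ GL₂⁺(ℚ)` as a real matrix, acting on `ℍ` by Möbius transformations. -/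
def toReal (α : GQ) : GL (Fin 2) ℝ :=
  Matrix.GeneralLinearGroup.map (algebraMap ℚ ℝ) (α : GL (Fin 2) ℚ)

/-- `(f |_w α)(z) = (cz+d)^{-w} f((az+b)/(cz+d))` (no determinant factor). -/
def slash (w : ℕ) (α : GQ) : (ℍ → ℂ) →ₗ[ℂ] (ℍ → ℂ) where
  toFun f z := (denom (toReal α) z) ^ (-(w : ℤ)) * f (toReal α • z)
  map_add' f g := by ext z; simp [mul_add]
  map_smul' c f := by ext z; simp [mul_left_comm]

/-- `f || α = ∑_{i,w} (a_{i,w} |_w α) G₂^i` for `f = ∑_{i,w} a_{i,w} G₂^i` in `QM`. -/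
def dslash (α : GQ) : (ℍ → ℂ) →ₗ[ℂ] (ℍ → ℂ) :=
  sumCoeffs (fun i w => LinearMap.mulRight ℂ (G2 ^ i) ∘ₗ slash w α) ∘ₗ coeffs

/-! ### The operators on the quasimodular tower -/

/-- `D(f) = -(1/8πi) ∑_i i a_i(f) G₂^{i-1} G₂'`. -/
def opD : (ℍ → ℂ) →ₗ[ℂ] (ℍ → ℂ) :=
  (-(1 / (8 * (Real.pi : ℂ) * Complex.I))) •
    (sumCoeffs (fun i _ => (i : ℂ) • LinearMap.mulRight ℂ (G2 ^ (i - 1) * G2')) ∘ₗ coeffs)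

/-- `W_k(f) = ∑_i i a_i(f) G₂^{i+k-2}` for `k ≥ 1` (the term `i = 0` vanishes, and
`i + k - 2 ≥ 0` in all others). -/
def opW (k : ℕ) : (ℍ → ℂ) →ₗ[ℂ] (ℍ → ℂ) :=
  sumCoeffs (fun i _ => (i : ℂ) • LinearMap.mulRight ℂ (G2 ^ (i + k - 2))) ∘ₗ coeffs

/-- `T_k^l(f) = G₄^l W_k(f)`. -/
def opT (k l : ℕ) (f : ℍ → ℂ) : ℍ → ℂ := G4 ^ l * opW k f

/-- `ν_α^{(m)} = -(5/24) (G₄^m | α - G₄^m)`, where `G₄^m` has weight `4m`. -/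
def nu (m : ℕ) (α : GQ) : ℍ → ℂ :=
  (-(5 / 24) : ℂ) • (slash (4 * m) α (G4 ^ m) - G4 ^ m)

/-! ### Quasimodular Hecke operators -/

/-- The inclusion `SL₂(ℤ) → GL₂⁺(ℚ)`. -/
def toGQ : SL(2, ℤ) →* GQ :=
  Matrix.SpecialLinearGroup.toGLPos.comp (Matrix.SpecialLinearGroup.map (Int.castRingHom ℚ))

/-- `Γ(N)` as a subgroup of `GL₂⁺(ℚ)`. -/
def levelQ (N : ℕ) : Subgroup GQ := (CongruenceSubgroup.Gamma N).map toGQ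

/-- The space `Q(Γ(N))` of quasimodular Hecke operators of level `Γ(N)`: functions
`F : Γ \ GL₂⁺(ℚ) → QM`, given as left `Γ`-invariant functions on `GL₂⁺(ℚ)`, supported on finitely
many cosets `Γα`, with `F_{αγ} = F_α || γ` for `γ ∈ Γ`. -/
def HeckeOps (N : ℕ) : Submodule ℂ (GQ → ℍ → ℂ) where
  carrier := {F |
    (∀ α, F α ∈ QM) ∧
    (∀ γ ∈ levelQ N, ∀ α, F (γ * α) = F α) ∧
    ((Quotient.mk (QuotientGroup.rightRel (levelQ N))) '' {α | F α ≠ 0}).Finite ∧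
    (∀ γ ∈ levelQ N, ∀ α, F (α * γ) = dslash γ (F α))}
  zero_mem' := ⟨fun _ => QM.zero_mem, fun _ _ _ => rfl, by simp, fun _ _ _ => by simp⟩
  add_mem' := by
    rintro F G ⟨h1, h2, h3, h4⟩ ⟨k1, k2, k3, k4⟩
    refine ⟨fun α => QM.add_mem (h1 α) (k1 α), fun γ hγ α => ?_, ?_, fun γ hγ α => ?_⟩
    · simp only [Pi.add_apply, h2 γ hγ α, k2 γ hγ α]
    · refine (h3.union k3).subset ?_
      rw [← Set.image_union]
      refine Set.image_mono fun α hα => ?_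
      by_contra hcon
      simp only [Set.mem_union, Set.mem_ofPred_eq, not_or, not_not] at hcon
      exact hα (by simp [hcon.1, hcon.2])
    · simp only [Pi.add_apply, h4 γ hγ α, k4 γ hγ α, map_add]
  smul_mem' := by
    rintro c F ⟨h1, h2, h3, h4⟩
    refine ⟨fun α => QM.smul_mem c (h1 α), fun γ hγ α => ?_, ?_, fun γ hγ α => ?_⟩
    · simp only [Pi.smul_apply, h2 γ hγ α]
    · refine h3.subset (Set.image_mono fun α hα h0 => hα ?_)
      simp [h0]
    · simp only [Pi.smul_apply, h4 γ hγ α, map_smul]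

/-! ### The Lie algebra `L` -/

/-- The symbols `D`, `T_k^l` (`k ≥ 1`, `l ≥ 0`) and `φ^{(m)}` (`m ≥ 1`). -/
inductive Symbols : Type
  | D : Symbols
  | T : ℕ+ → ℕ → Symbols
  | phi : ℕ+ → Symbols

/-- The free complex Lie algebra on the symbols. -/
abbrev FreeL : Type := FreeLieAlgebra ℂ Symbols

/-- The symbol `D` in the free Lie algebra. -/
def freeD : FreeL := FreeLieAlgebra.of ℂ Symbols.D

/-- The symbol `T_k^l` in the free Lie algebra; `T_0^l`, which occurs in the relations
with coefficient `0` only, is read as `0`. -/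
def freeT (k l : ℕ) : FreeL :=
  if h : 0 < k then FreeLieAlgebra.of ℂ (Symbols.T ⟨k, h⟩ l) else 0

/-- The symbol `φ^{(m)}` in the free Lie algebra. -/
def freePhi (m : ℕ+) : FreeL := FreeLieAlgebra.of ℂ (Symbols.phi m)

/-- The defining relations of `L`, written as elements that have to vanish. -/
inductive IsRelator : FreeL → Prop
  | TT (k k' l l' : ℕ) (hk : 1 ≤ k) (hk' : 1 ≤ k') :
      IsRelator (⁅freeT k l, freeT k' l'⁆ - ((k' : ℂ) - (k : ℂ)) • freeT (k + k' - 2) (l + l'))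
  | Dphi (m : ℕ+) : IsRelator ⁅freeD, freePhi m⁆
  | Tphi (k l : ℕ) (m : ℕ+) (hk : 1 ≤ k) : IsRelator ⁅freeT k l, freePhi m⁆
  | phiphi (m m' : ℕ+) : IsRelator ⁅freePhi m, freePhi m'⁆
  | TD (k l : ℕ) (hk : 1 ≤ k) :
      IsRelator (⁅freeT k l, freeD⁆ - (((5 / 24 : ℂ) * ((k : ℂ) - 1)) • freeT (k - 1) (l + 1) -
        ((1 / 2 : ℂ) * ((k : ℂ) - 3)) • freeT (k + 1) l))

/-- The ideal generated by the relations. -/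
def relIdeal : LieIdeal ℂ FreeL := LieSubmodule.lieSpan ℂ FreeL {x | IsRelator x}

/-- The Lie algebra `L`: generated by the symbols `D`, `T_k^l`, `φ^{(m)}`, subject to the
relations. -/
abbrev LieL : Type := FreeL ⧸ relIdeal

/-- The generator of `L` attached to a symbol. -/
def gen (x : Symbols) : LieL := LieSubmodule.Quotient.mk (N := relIdeal) (FreeLieAlgebra.of ℂ x)

end

end QuasimodularHecke

/-!
By Ramanujan's identity `G₂' = 2πi (5/6 G₄ - 2 G₂²)`, both `D` and `T_k^l` are vector fields
`p ∂/∂G₂` with `p ∈ ℂ[G₂, G₄]` on the ring `QM = M[G₂]` of polynomials in `G₂` over the ring `M` of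
all modular forms. Hence `D` and the `T_k^l` kill modular forms, so they commute with the
multiplications by the modular forms `ν_α^{(m)}`, and the remaining relations are brackets of vector
fields in one variable. The substitution `f ↦ f ‖ α` is a ring homomorphism commuting with `∂/∂G₂`;
as `G₂` and `G₄` are fixed by `‖ γ` for `γ ∈ SL₂(ℤ)`, so are the components `p`, which makes the
operators compatible with the action of `Γ(N)`.

That `QM = M[G₂]`, freely (Kaneko–Zagier), holds because the pairs `(cz + d, c)` attached to `Γ(N)`
are Zariski dense. They turn a relation `∑ aᵢ G₂ⁱ = 0` with modular `aᵢ` into a polynomial identity,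
whence all `aᵢ = 0`; and for a quasimodular form the polynomials `P_z = ∑ f_j(z) Xʲ` satisfy
`P_{γz}(X) = (cz + d)ᵏ P_z((cz + d)⁻² X + c / (cz + d))`, so the top coefficient `f_s` is modular of
weight `k - 2s`, and subtracting a multiple of `f_s G₂ˢ` lowers the depth.
-/

namespace QuasimodularHecke

noncomputable section

/-! ### Eisenstein series of weight two and four -/

theorem G2_eq : G2 = (-(1 / 24) : ℂ) • EisensteinSeries.E2 := by
  ext z
  have cexp_eq_pow (n : ℕ+) : Complex.exp (2 * (Real.pi : ℂ) * Complex.I * (n : ℂ) * (z : ℂ)) =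
      Complex.exp (2 * (Real.pi : ℂ) * Complex.I * (z : ℂ)) ^ (n : ℕ) := by
    rw [← Complex.exp_nat_mul]
    ring_nf
  have bernoulli_two : bernoulli 2 = 1 / 6 := by
    rw [bernoulli_eq_bernoulli'_of_ne_one (by norm_num), bernoulli'_two]
  simp only [G2, eisG, cexp_eq_pow, bernoulli_two, Pi.smul_apply, smul_eq_mul,
    EisensteinSeries.E2_eq_tsum_cexp, Nat.add_one_sub_one]
  push_cast
  ring

theorem G4_eq : G4 = (1 / 240 : ℂ) • ⇑ModularForm.E₄ := by
  ext z
  have cexp_eq_zpow (n : ℕ+) : Complex.exp (2 * (Real.pi : ℂ) * Complex.I * (n : ℂ) * (z : ℂ)) =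
      Complex.exp (2 * (Real.pi : ℂ) * Complex.I * (z : ℂ)) ^ ((n : ℕ) : ℤ) := by
    rw [zpow_natCast, ← Complex.exp_nat_mul]
    ring_nf
  have bernoulli_four : bernoulli 4 = -1 / 30 := by
    rw [bernoulli_eq_bernoulli'_of_ne_one (by norm_num), bernoulli'_four]
  rw [Pi.smul_apply, EisensteinSeries.q_expansion_bernoulli (by norm_num) ⟨2, rfl⟩]
  simp only [G4, eisG, cexp_eq_zpow, bernoulli_four, smul_eq_mul, Nat.add_one_sub_one]
  push_cast
  ring

theorem mdifferentiable_G2 : MDiff G2 :=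
  G2_eq ▸ E2_mdifferentiable.const_smul _

/-- The function `X(γ)(z) = c / (cz + d)`, which measures the failure of `G₂` to be modular. It is
the variable of the polynomial in the definition of a quasimodular form. -/
def cocycle (γ : SL(2, ℤ)) (z : ℍ) : ℂ := ((γ 1 0 : ℤ) : ℂ) / denom γ z

theorem cocycle_mul (γ δ : SL(2, ℤ)) (z : ℍ) :
    cocycle (γ * δ) z = cocycle γ (δ • z) / denom δ z ^ 2 + cocycle δ z := by
  have D2_eq (γ : SL(2, ℤ)) (z : ℍ) :
      EisensteinSeries.D2 γ z = 2 * (Real.pi : ℂ) * Complex.I * cocycle γ z := by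
    rw [EisensteinSeries.D2, cocycle, mul_div_assoc]
  have h := congrFun (EisensteinSeries.D2_mul γ δ) z
  rw [Pi.add_apply, ModularForm.SL_slash_apply, D2_eq, D2_eq, D2_eq, zpow_neg, zpow_ofNat] at h
  apply mul_left_cancel₀ Complex.two_pi_I_ne_zero
  linear_combination h

/-- The constant `-1 / (4πi)` in the transformation law of `G₂`. -/
def kappa : ℂ := -(4 * (Real.pi : ℂ) * Complex.I)⁻¹

theorem kappa_ne_zero : kappa ≠ 0 := by
  simp [kappa, Real.pi_ne_zero]

theorem apply_smul_of_slash_eq {w : ℤ} {f g : ℍ → ℂ} {γ : SL(2, ℤ)} (h : f ∣[w] γ = g) (z : ℍ) :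
    f (γ • z) = denom γ z ^ w * g z := by
  rw [← h, ModularForm.SL_slash_apply, mul_left_comm, mul_comm (denom γ z ^ w),
    zpow_neg_mul_zpow_self _ (denom_ne_zero γ z), mul_one]

theorem G2_slash (γ : SL(2, ℤ)) : G2 ∣[(2 : ℤ)] γ = G2 + kappa • cocycle γ := by
  have hπ : (Real.pi : ℂ) ≠ 0 := by exact_mod_cast Real.pi_ne_zero
  have hI := Complex.I_sq
  ext z
  have hj := denom_ne_zero γ z
  rw [G2_eq, ModularForm.SL_smul_slash, EisensteinSeries.E2_slash_action]
  simp only [kappa, cocycle, EisensteinSeries.D2, riemannZeta_two, Pi.add_apply, Pi.sub_apply,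
    Pi.smul_apply, smul_eq_mul]
  field_simp
  linear_combination (24 * ((γ 1 0 : ℤ) : ℂ)) * hI

theorem G2_smul (γ : SL(2, ℤ)) (z : ℍ) :
    G2 (γ • z) = denom γ z ^ 2 * (G2 z + kappa * cocycle γ z) :=
  apply_smul_of_slash_eq (G2_slash γ) z

theorem isBoundedAtImInfty_cocycle (γ : SL(2, ℤ)) : IsBoundedAtImInfty (cocycle γ) := by
  rw [isBoundedAtImInfty_iff]
  refine ⟨1, 1, fun z hz ↦ ?_⟩
  have him : (denom γ z).im = (γ 1 0 : ℝ) * z.im := by simp [ModularGroup.denom_apply]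
  rw [cocycle, norm_div, div_le_one (norm_pos_iff.mpr (denom_ne_zero γ z))]
  calc ‖((γ 1 0 : ℤ) : ℂ)‖ = |(γ 1 0 : ℝ)| := by simp
    _ ≤ |(γ 1 0 : ℝ)| * z.im := le_mul_of_one_le_right (abs_nonneg _) hz
    _ = |(denom γ z).im| := by rw [him, abs_mul, abs_of_pos z.im_pos]
    _ ≤ ‖denom γ z‖ := Complex.abs_im_le_norm _

theorem isBoundedAtImInfty_G2_slash (γ : SL(2, ℤ)) : IsBoundedAtImInfty (G2 ∣[(2 : ℤ)] γ) := by
  rw [G2_slash, G2_eq]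
  exact (EisensteinSeries.isBoundedAtImInfty_E2.const_mul_left _).add
    ((isBoundedAtImInfty_cocycle γ).const_mul_left _)

/-! ### Ramanujan's identity -/

open Filter Topology Function.Periodic

section QExpansion

variable {f : ℍ → ℂ} {c : ℕ → ℂ}

theorem periodic_of_hasSum_qExpansion
    (hsum : ∀ τ : ℍ, HasSum (fun m ↦ c m • qParam 1 τ ^ m) (f τ)) :
    Function.Periodic (f ∘ ofComplex) (1 : ℝ) := by
  intro w
  by_cases! hw : 0 < w.im
  · have hw' : 0 < (w + (1 : ℝ)).im := by simpa using hw
    simp only [Function.comp_apply, ofComplex_apply_of_im_pos hw, ofComplex_apply_of_im_pos hw']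
    refine (hsum _).unique ?_
    convert hsum ⟨w, hw⟩ using 4
    simp [qParam, mul_add, Complex.exp_add]
  · have hw' : (w + (1 : ℝ)).im ≤ 0 := by simpa using hw
    simp only [Function.comp_apply, ofComplex_apply_of_im_nonpos hw,
      ofComplex_apply_of_im_nonpos hw']

theorem analyticAt_cuspFunction_of_hasSum_qExpansion (hf : MDiff f)
    (hsum : ∀ τ : ℍ, HasSum (fun m ↦ c m • qParam 1 τ ^ m) (f τ)) :
    AnalyticAt ℂ (UpperHalfPlane.cuspFunction 1 f) 0 :=
  analyticAt_cuspFunction_zero one_pos (periodic_of_hasSum_qExpansion hsum) hf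
    (isBoundedAtImInfty_of_hasSum_qExpansion one_pos hsum)

theorem tendsto_atImInfty_of_hasSum_qExpansion (hf : MDiff f)
    (hsum : ∀ τ : ℍ, HasSum (fun m ↦ c m • qParam 1 τ ^ m) (f τ)) :
    Tendsto f atImInfty (𝓝 (c 0)) := by
  have hF := analyticAt_cuspFunction_of_hasSum_qExpansion hf hsum
  have hc : UpperHalfPlane.cuspFunction 1 f 0 = c 0 := by
    simpa using ((hasFPowerSeriesOnBall_cuspFunction one_pos hF hsum).coeff_zero 0).symm
  simpa only [Function.comp_def, hc,
    UpperHalfPlane.eq_cuspFunction _ one_ne_zero (periodic_of_hasSum_qExpansion hsum)] using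
    hF.continuousAt.tendsto.comp (qParam_tendsto_atImInfty one_pos)

/-- For `f = F(q)` with `F` holomorphic at `q = 0`, the derivative `q F'(q)` vanishes at `q = 0`. -/
theorem isZeroAtImInfty_normalizedDerivOfComplex_of_hasSum_qExpansion (hf : MDiff f)
    (hsum : ∀ τ : ℍ, HasSum (fun m ↦ c m • qParam 1 τ ^ m) (f τ)) :
    IsZeroAtImInfty (Derivative.normalizedDerivOfComplex f) := by
  have hF := analyticAt_cuspFunction_of_hasSum_qExpansion hf hsum
  have hper := periodic_of_hasSum_qExpansion hsum
  have hbdd := isBoundedAtImInfty_of_hasSum_qExpansion one_pos hsum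
  have deriv_eq (τ : ℍ) : Derivative.normalizedDerivOfComplex f τ =
      qParam 1 τ * deriv (UpperHalfPlane.cuspFunction 1 f) (qParam 1 τ) := by
    have hq : HasDerivAt (fun w ↦ qParam 1 w) (qParam 1 τ * (2 * Real.pi * Complex.I)) τ := by
      simpa [qParam] using (((hasDerivAt_id (τ : ℂ)).const_mul (2 * Real.pi * Complex.I)).cexp)
    have hFq := (differentiableAt_cuspFunction one_pos hper hf hbdd
      (norm_qParam_lt_one one_pos τ.im_pos)).hasDerivAt.comp _ hq
    have hcomp : UpperHalfPlane.cuspFunction 1 f ∘ qParam 1 = f ∘ ofComplex :=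
      funext (Function.Periodic.eq_cuspFunction one_ne_zero hper)
    rw [hcomp] at hFq
    rw [Derivative.normalizedDerivOfComplex, hFq.deriv]
    field [Complex.two_pi_I_ne_zero]
  have hlim := (continuousAt_id.mul hF.deriv.continuousAt).tendsto.comp
    (qParam_tendsto_atImInfty one_pos)
  rw [IsZeroAtImInfty, ZeroAtFilter]
  simpa [Function.comp_def, ← deriv_eq] using hlim

end QExpansion

theorem hasSum_qExpansion_G2 (τ : ℍ) :
    HasSum (fun m : ℕ ↦ (if m = 0 then -(1 / 24) else ArithmeticFunction.sigma 1 m : ℂ) •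
      qParam 1 τ ^ m) (G2 τ) := by
  have h := (EisensteinSeries.hasSum_qExpansion_E2 (z := τ)).const_smul (-(1 / 24) : ℂ)
  rw [G2_eq, Pi.smul_apply]
  refine h.congr_fun fun m ↦ ?_
  split_ifs <;> simp [qParam, mul_assoc]

theorem tendsto_E4_atImInfty : Tendsto (ModularForm.E₄ : ℍ → ℂ) atImInfty (𝓝 1) := by
  have h := tendsto_atImInfty_of_hasSum_qExpansion ModularForm.E₄.holo'
    (ModularForm.hasSum_qExpansion ModularForm.E₄ one_pos (by simp))
  rwa [EisensteinSeries.E_qExpansion_coeff_zero (by norm_num) ⟨2, rfl⟩] at h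

theorem hasDerivAt_cocycle (γ : SL(2, ℤ)) (z : ℍ) :
    HasDerivAt (cocycle γ ∘ ofComplex) (-cocycle γ z ^ 2) z := by
  have hdenom : HasDerivAt (fun w : ℂ ↦ ((γ 1 0 : ℤ) : ℂ) * denom γ w ^ (-1 : ℤ))
      (-cocycle γ z ^ 2) z := by
    refine ((hasDerivAt_denom_zpow γ (-1) z).const_mul ((γ 1 0 : ℤ) : ℂ)).congr_deriv ?_
    have hj := denom_ne_zero γ z
    have hγ : (Matrix.SpecialLinearGroup.toGL
        (Matrix.SpecialLinearGroup.map (Int.castRingHom ℝ) γ) 1 0 : ℂ) = (γ 1 0 : ℤ) := by simp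
    simp only [cocycle, Int.reduceSub, Int.cast_neg, Int.cast_one, hγ]
    field_simp
  refine hdenom.congr_of_eventuallyEq ?_
  filter_upwards [isOpen_upperHalfPlaneSet.mem_nhds z.im_pos] with w hw
  rw [Function.comp_apply, ofComplex_apply_of_im_pos hw, cocycle, zpow_neg_one, div_eq_mul_inv]

theorem normalizedDerivOfComplex_cocycle (γ : SL(2, ℤ)) :
    Derivative.normalizedDerivOfComplex (cocycle γ) = (2 * kappa) • cocycle γ ^ 2 := by
  ext z
  rw [Derivative.normalizedDerivOfComplex, (hasDerivAt_cocycle γ z).deriv]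
  simp only [kappa, Pi.smul_apply, Pi.pow_apply, smul_eq_mul, mul_inv]
  ring

theorem mdifferentiable_cocycle (γ : SL(2, ℤ)) : MDiff (cocycle γ) := fun z ↦
  mdifferentiableAt_iff.mpr (hasDerivAt_cocycle γ z).differentiableAt

theorem normalizedDerivOfComplex_G2_slash (γ : SL(2, ℤ)) :
    Derivative.normalizedDerivOfComplex G2 ∣[(4 : ℤ)] γ = Derivative.normalizedDerivOfComplex G2 -
      (4 * kappa) • (G2 * cocycle γ) - (2 * kappa ^ 2) • cocycle γ ^ 2 := by
  have h := Derivative.normalizedDerivOfComplex_SL_slash (k := 2) mdifferentiable_G2 (γ := γ)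
  rw [G2_slash, Derivative.normalizedDerivOfComplex_add _ _ mdifferentiable_G2
    ((mdifferentiable_cocycle γ).const_smul kappa), Derivative.normalizedDerivOfComplex_smul _ _
    (mdifferentiable_cocycle γ), normalizedDerivOfComplex_cocycle, eq_sub_iff_add_eq] at h
  rw [show (4 : ℤ) = 2 + 2 from rfl, ← h]
  ext z
  simp only [kappa, cocycle, Pi.add_apply, Pi.sub_apply, Pi.smul_apply, Pi.mul_apply, Pi.pow_apply,
    smul_eq_mul]
  push_cast
  ring

theorem serreDerivative_G2_slash (γ : SL(2, ℤ)) :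
    (Derivative.normalizedDerivOfComplex G2 + (2 : ℂ) • (G2 * G2)) ∣[(4 : ℤ)] γ =
      Derivative.normalizedDerivOfComplex G2 + (2 : ℂ) • (G2 * G2) := by
  rw [SlashAction.add_slash, normalizedDerivOfComplex_G2_slash, ModularForm.SL_smul_slash,
    show (4 : ℤ) = 2 + 2 from rfl, ModularForm.mul_slash_SL2, G2_slash]
  ext z
  simp only [Pi.add_apply, Pi.sub_apply, Pi.smul_apply, Pi.mul_apply, Pi.pow_apply, smul_eq_mul]
  ring

theorem tendsto_serreDerivative_G2 :
    Tendsto (Derivative.normalizedDerivOfComplex G2 + (2 : ℂ) • (G2 * G2)) atImInfty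
      (𝓝 (1 / 288)) := by
  have hG2 : Tendsto G2 atImInfty (𝓝 (-(1 / 24))) := by
    simpa using tendsto_atImInfty_of_hasSum_qExpansion mdifferentiable_G2 hasSum_qExpansion_G2
  have hD : Tendsto (Derivative.normalizedDerivOfComplex G2) atImInfty (𝓝 0) :=
    isZeroAtImInfty_normalizedDerivOfComplex_of_hasSum_qExpansion mdifferentiable_G2
      hasSum_qExpansion_G2
  have hlim := hD.add ((hG2.mul hG2).const_mul 2)
  norm_num at hlim
  exact hlim

/-- The Serre derivative `(2πi)⁻¹ G₂' + 2 G₂²` of `G₂`, as a modular form of level one. -/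
def serreDerivativeG2 : ModularForm 𝒮ℒ 4 where
  toFun := Derivative.normalizedDerivOfComplex G2 + (2 : ℂ) • (G2 * G2)
  slash_action_eq' := fun _ ⟨γ, hγ⟩ ↦ hγ ▸ serreDerivative_G2_slash γ
  holo' := (Derivative.normalizedDerivOfComplex_mdifferentiable mdifferentiable_G2).add
    ((mdifferentiable_G2.mul mdifferentiable_G2).const_smul _)
  bdd_at_cusps' {c} hc := by
    rw [Subgroup.IsArithmetic.isCusp_iff_isCusp_SL2Z] at hc
    rw [OnePoint.isBoundedAt_iff_forall_SL2Z hc]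
    intro γ _
    rw [serreDerivative_G2_slash γ]
    exact tendsto_serreDerivative_G2.isBigO_one ℝ

/-- The modular forms of level one and weight four are the multiples of `E₄`; the multiple is read
off at infinity. -/
theorem serreDerivativeG2_eq : ⇑serreDerivativeG2 = (5 / 6 : ℂ) • G4 := by
  obtain ⟨c, hc⟩ := exists_smul_eq_of_finrank_eq_one
    (Module.rank_eq_one_iff_finrank_eq_one.mp ModularForm.levelOne_weight_four_rank_one)
    (EisensteinSeries.E_ne_zero (by norm_num : 3 ≤ 4) ⟨2, rfl⟩) serreDerivativeG2
  have hfun : ⇑serreDerivativeG2 = c • ⇑ModularForm.E₄ := congrArg DFunLike.coe hc.symm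
  have hlim : Tendsto serreDerivativeG2 atImInfty (𝓝 (c • 1)) :=
    hfun ▸ tendsto_E4_atImInfty.const_smul c
  have hc : c = 1 / 288 := by
    simpa using tendsto_nhds_unique hlim tendsto_serreDerivative_G2
  rw [hfun, hc, G4_eq, smul_smul]
  norm_num

theorem G2'_eq : G2' = (2 * (Real.pi : ℂ) * Complex.I) • ((5 / 6 : ℂ) • G4 - (2 : ℂ) • G2 ^ 2) := by
  ext z
  have h := congrFun serreDerivativeG2_eq z
  change (2 * (Real.pi : ℂ) * Complex.I)⁻¹ * G2' z + 2 * (G2 z * G2 z) = _ at h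
  rw [← eq_sub_iff_add_eq, inv_mul_eq_iff_eq_mul₀ Complex.two_pi_I_ne_zero] at h
  rw [h, pow_two]
  rfl

/-! ### The modular tower -/

theorem toReal_mul (α β : GQ) : toReal (α * β) = toReal α * toReal β := by
  simp [toReal]

theorem det_toReal_pos (α : GQ) : 0 < (toReal α).det.val := by
  have h := α.2
  rw [Matrix.mem_glpos] at h
  simpa [toReal, Matrix.GeneralLinearGroup.map_det] using h

theorem sigma_toReal (α : GQ) (z : ℂ) : σ (toReal α) z = z := by
  rw [σ, if_pos (det_toReal_pos α)]
  rfl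

theorem toReal_toGQ (γ : SL(2, ℤ)) :
    toReal (toGQ γ) = Matrix.SpecialLinearGroup.mapGL ℝ γ := by
  ext i j
  simp [toReal, toGQ]

theorem slash_apply (w : ℕ) (α : GQ) (f : ℍ → ℂ) (z : ℍ) :
    slash w α f z = (denom (toReal α) z) ^ (-(w : ℤ)) * f (toReal α • z) := rfl

theorem slash_mul_right (w : ℕ) (α β : GQ) (f : ℍ → ℂ) :
    slash w (α * β) f = slash w β (slash w α f) := by
  ext z
  simp only [slash_apply, toReal_mul, mul_smul]
  rw [denom_cocycle_σ, sigma_toReal, mul_zpow]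
  ring

theorem slash_mul (w w' : ℕ) (α : GQ) (f g : ℍ → ℂ) :
    slash (w + w') α (f * g) = slash w α f * slash w' α g := by
  ext z
  simp only [slash_apply, Pi.mul_apply, Nat.cast_add, neg_add, zpow_add₀ (denom_ne_zero _ z)]
  ring

theorem slash_toGQ (w : ℕ) (γ : SL(2, ℤ)) (f : ℍ → ℂ) :
    slash w (toGQ γ) f = f ∣[(w : ℤ)] γ := by
  ext z
  rw [slash_apply, ModularForm.SL_slash_apply, toReal_toGQ, mul_comm]
  rfl

theorem slash_eq_smul (w : ℕ) (α : GQ) (f : ℍ → ℂ) :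
    slash w α f =
      (((|(toReal α).det.val| : ℝ) : ℂ) ^ ((w : ℤ) - 1))⁻¹ • (f ∣[(w : ℤ)] toReal α) := by
  have hd : (((|(toReal α).det.val| : ℝ) : ℂ)) ≠ 0 := by
    exact_mod_cast (abs_pos.mpr (det_toReal_pos α).ne').ne'
  ext z
  simp only [slash_apply, Pi.smul_apply, ModularForm.slash_apply, sigma_toReal, smul_eq_mul]
  field_simp

/-- A holomorphic function, invariant under `Γ(N)` and bounded at all cusps, as a modular form. -/
def mkModularForm {N : ℕ} [NeZero N] {w : ℤ} {f : ℍ → ℂ} (hol : MDiff f)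
    (inv : ∀ γ ∈ CongruenceSubgroup.Gamma N, f ∣[w] γ = f)
    (bdd : ∀ γ : SL(2, ℤ), IsBoundedAtImInfty (f ∣[w] γ)) : ModularForm (levelR N) w where
  toFun := f
  slash_action_eq' := fun _ ⟨γ, hγ, e⟩ ↦ e ▸ inv γ hγ
  holo' := hol
  bdd_at_cusps' := fun {c} hc ↦ by
    rw [Subgroup.IsArithmetic.isCusp_iff_isCusp_SL2Z] at hc
    rw [OnePoint.isBoundedAt_iff_forall_SL2Z hc]
    exact fun γ _ ↦ bdd γ

theorem isModularForm_iff {N w : ℕ} (hN : 1 ≤ N) {f : ℍ → ℂ} :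
    IsModularForm N w f ↔ MDiff f ∧
      (∀ γ ∈ CongruenceSubgroup.Gamma N, f ∣[(w : ℤ)] γ = f) ∧
      ∀ γ : SL(2, ℤ), IsBoundedAtImInfty (f ∣[(w : ℤ)] γ) := by
  have : NeZero N := ⟨by omega⟩
  constructor
  · rintro ⟨g, rfl⟩
    exact ⟨g.holo', fun γ hγ ↦ g.slash_action_eq' _ ⟨γ, hγ, rfl⟩,
      fun γ ↦ ModularFormClass.bdd_at_infty_slash g γ⟩
  · rintro ⟨hol, inv, bdd⟩
    exact ⟨mkModularForm hol inv bdd, rfl⟩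

theorem mul_mem_modularTower {w w' : ℕ} {f g : ℍ → ℂ} (hf : f ∈ modularTower w)
    (hg : g ∈ modularTower w') : f * g ∈ modularTower (w + w') := by
  obtain ⟨N, hN, hf⟩ := hf
  obtain ⟨N', hN', hg⟩ := hg
  obtain ⟨f', rfl⟩ := hf.mono (Dvd.intro N' rfl)
  obtain ⟨g', rfl⟩ := hg.mono (Dvd.intro_left N rfl)
  have : NeZero (N * N') := ⟨(Nat.mul_pos hN hN').ne'⟩
  exact ⟨N * N', Nat.mul_pos hN hN', (f'.mul g').mcast (by push_cast; rfl), rfl⟩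

theorem one_mem_modularTower : (1 : ℍ → ℂ) ∈ modularTower 0 :=
  ⟨1, le_rfl, (1 : ModularForm (levelR 1) 0), rfl⟩

theorem pow_mem_modularTower {w : ℕ} {f : ℍ → ℂ} (hf : f ∈ modularTower w) (m : ℕ) :
    f ^ m ∈ modularTower (w * m) := by
  induction m with
  | zero => simpa using one_mem_modularTower
  | succ m ih => exact mul_mem_modularTower ih hf

theorem G4_slash (γ : SL(2, ℤ)) : G4 ∣[(4 : ℤ)] γ = G4 := by
  rw [G4_eq, ModularForm.SL_smul_slash]
  exact congrArg _ (ModularForm.E₄.slash_action_eq' _ ⟨γ, rfl⟩)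

theorem G4_mem_modularTower : G4 ∈ modularTower 4 := by
  rw [G4_eq]
  exact Submodule.smul_mem _ _ ⟨1, le_rfl, (isModularForm_iff le_rfl).mpr
    ⟨ModularForm.E₄.holo', fun γ _ ↦ ModularForm.E₄.slash_action_eq' _ ⟨γ, rfl⟩,
      fun γ ↦ ModularFormClass.bdd_at_infty_slash ModularForm.E₄ γ⟩⟩

open scoped Pointwise in
theorem slash_mem_modularTower {w : ℕ} {f : ℍ → ℂ} (α : GQ) (hf : f ∈ modularTower w) :
    slash w α f ∈ modularTower w := by
  obtain ⟨N, hN, g, rfl⟩ := hf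
  have : NeZero N := ⟨by omega⟩
  obtain ⟨N', hN', hle⟩ := CongruenceSubgroup.exists_Gamma_le_conj' (α : GL (Fin 2) ℚ) N
  have hle' : levelR N' ≤ ConjAct.toConjAct (toReal α)⁻¹ • levelR N := by
    rw [ConjAct.toConjAct_inv, ← Subgroup.pointwise_smul_subset_iff]
    exact hle
  rw [slash_eq_smul]
  refine Submodule.smul_mem _ _ ⟨N', Nat.one_le_iff_ne_zero.mpr hN', ?_⟩
  let t : ModularForm _ (w : ℤ) := ModularForm.translate g (toReal α)
  exact ⟨{ toFun := t
           slash_action_eq' := fun γ hγ ↦ t.slash_action_eq' γ (hle' hγ)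
           holo' := t.holo'
           bdd_at_cusps' := fun hc ↦ t.bdd_at_cusps' (hc.mono hle') }, rfl⟩

theorem G4_pow_slash (m : ℕ) (γ : SL(2, ℤ)) :
    slash (4 * m) (toGQ γ) (G4 ^ m) = G4 ^ m := by
  induction m with
  | zero => ext z; simp [slash_apply]
  | succ m ih =>
    rw [Nat.mul_succ, pow_succ, slash_mul, ih, slash_toGQ]
    exact congrArg _ (G4_slash γ)

theorem nu_mem_modularTower (m : ℕ) (α : GQ) : nu m α ∈ modularTower (4 * m) :=
  Submodule.smul_mem _ _ (Submodule.sub_mem _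
    (slash_mem_modularTower α (pow_mem_modularTower G4_mem_modularTower m))
    (pow_mem_modularTower G4_mem_modularTower m))

theorem nu_mul_left (m : ℕ) (γ : SL(2, ℤ)) (α : GQ) : nu m (toGQ γ * α) = nu m α := by
  rw [nu, slash_mul_right, G4_pow_slash, nu]

theorem nu_mul_right (m : ℕ) (γ : SL(2, ℤ)) (α : GQ) :
    nu m (α * toGQ γ) = slash (4 * m) (toGQ γ) (nu m α) := by
  rw [nu, slash_mul_right, nu, map_smul, map_sub, G4_pow_slash]

theorem eq_zero_of_slash_invariant_of_neg {N : ℕ} (hN : 1 ≤ N) {w : ℤ} (hw : w < 0) {f : ℍ → ℂ}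
    (hol : MDiff f) (inv : ∀ γ ∈ CongruenceSubgroup.Gamma N, f ∣[w] γ = f)
    (bdd : ∀ γ : SL(2, ℤ), IsBoundedAtImInfty (f ∣[w] γ)) : f = 0 := by
  have : NeZero N := ⟨by omega⟩
  exact congrArg DFunLike.coe (ModularForm.isZero_of_neg_weight hw (mkModularForm hol inv bdd))

/-! ### Linear independence of the powers of `G₂` -/

/-- An element of `Γ(N)` with lower row `(Nm, 1 + N²mn)`. -/
def gammaElt (N : ℕ) (m n : ℤ) : SL(2, ℤ) :=
  ⟨!![1, N * n; N * m, 1 + N * m * (N * n)], by simp [Matrix.det_fin_two]; ring⟩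

theorem gammaElt_mem (N : ℕ) (m n : ℤ) : gammaElt N m n ∈ CongruenceSubgroup.Gamma N := by
  rw [CongruenceSubgroup.Gamma_mem]
  simp [gammaElt]

theorem denom_gammaElt (N : ℕ) (m n : ℤ) (z : ℍ) :
    denom (gammaElt N m n) z = (N * m : ℂ) * z + (1 + N * m * (N * n)) := by
  rw [ModularGroup.denom_apply]
  simp [gammaElt]

theorem infinite_range_denom {N : ℕ} (hN : 1 ≤ N) {m : ℤ} (hm : m ≠ 0) (z : ℍ) :
    (Set.range fun n : ℤ ↦ denom (gammaElt N m n) z).Infinite := by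
  refine Set.infinite_range_of_injective fun n n' h ↦ ?_
  have hN' : (N : ℂ) ≠ 0 := by exact_mod_cast (by omega : N ≠ 0)
  have hm' : (m : ℂ) ≠ 0 := by exact_mod_cast hm
  simp only [denom_gammaElt] at h
  have h' : (N * m * N : ℂ) * n = (N * m * N : ℂ) * n' := by linear_combination h
  exact_mod_cast mul_left_cancel₀ (mul_ne_zero (mul_ne_zero hN' hm') hN') h'

open Polynomial Polynomial.Bivariate in
theorem eq_zero_of_infinite_evalEval_eq_zero {R : Type*} [CommRing R] [IsDomain R] {P : R[X][Y]}
    {s : Set R} {t : R → Set R} (hs : s.Infinite) (ht : ∀ x ∈ s, (t x).Infinite)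
    (h : ∀ x ∈ s, ∀ y ∈ t x, P.evalEval x y = 0) : P = 0 := by
  have map_eq_zero : ∀ x ∈ s, P.map (evalRingHom x) = 0 := fun x hx ↦
    eq_zero_of_infinite_isRoot _ <| (ht x hx).mono fun y hy ↦ by
      simpa only [Set.mem_ofPred_eq, IsRoot.def, map_evalRingHom_eval] using h x hx y hy
  ext1 n
  refine eq_zero_of_infinite_isRoot _ (hs.mono fun x hx ↦ ?_)
  simpa using congrArg (coeff · n) (map_eq_zero x hx)

open Polynomial Polynomial.Bivariate in
theorem eq_zero_of_infinite_sum_mul_pow_mul_pow_eq_zero {ι R : Type*} [CommRing R] [IsDomain R]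
    {S : Finset ι} {e : ι → ℕ × ℕ} (he : Function.Injective e) {a : ι → R} {s : Set R}
    {t : R → Set R} (hs : s.Infinite) (ht : ∀ x ∈ s, (t x).Infinite)
    (h : ∀ x ∈ s, ∀ y ∈ t x, ∑ p ∈ S, a p * x ^ (e p).1 * y ^ (e p).2 = 0) :
    ∀ p ∈ S, a p = 0 := by
  let P : R[X][Y] := ∑ p ∈ S, monomial (e p).2 (monomial (e p).1 (a p))
  have hP : P = 0 := eq_zero_of_infinite_evalEval_eq_zero hs ht fun x hx y hy ↦ by
    simpa only [P, evalEval_finsetSum, evalEval, eval_monomial, eval_mul, eval_pow, eval_C] using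
      h x hx y hy
  intro p hp
  have hcoeff : (P.coeff (e p).2).coeff (e p).1 = a p := by
    simp only [P, finsetSum_coeff]
    rw [Finset.sum_eq_single_of_mem p hp, coeff_monomial_same, coeff_monomial_same]
    intro q _ hqp
    rw [coeff_monomial]
    split_ifs with h2
    · exact coeff_monomial_of_ne _ fun h1 ↦ hqp (he (Prod.ext h1.symm h2))
    · exact coeff_zero _
  rw [← hcoeff, hP, coeff_zero, coeff_zero]

section Uniqueness

variable {N : ℕ} {S : Finset (ℕ × ℕ)} {a : ℕ × ℕ → ℍ → ℂ}

theorem sum_mul_denom_pow_mul_pow_eq_zero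
    (ha : ∀ p ∈ S, ∀ γ ∈ CongruenceSubgroup.Gamma N, a p ∣[(p.2 : ℤ)] γ = a p)
    (h : ∀ z, ∑ p ∈ S, a p z * G2 z ^ p.1 = 0) {γ : SL(2, ℤ)}
    (hγ : γ ∈ CongruenceSubgroup.Gamma N) (z : ℍ) :
    ∑ p ∈ S, a p z * denom γ z ^ (p.2 + p.1) * (G2 z * denom γ z + kappa * (γ 1 0 : ℤ)) ^ p.1 =
      0 := by
  rw [← h (γ • z)]
  refine Finset.sum_congr rfl fun p hp ↦ ?_
  have hj := denom_ne_zero γ z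
  have hG : G2 (γ • z) = denom γ z * (G2 z * denom γ z + kappa * (γ 1 0 : ℤ)) := by
    rw [G2_smul, cocycle]
    field_simp
  rw [apply_smul_of_slash_eq (ha p hp γ hγ) z, zpow_natCast, hG, mul_pow, pow_add]
  ring

/-- The relation `∑ a_p G₂^i = 0` transforms under `Γ(N)` into a polynomial relation between
`cz + d` and `c`, which are independent enough for all its coefficients to vanish. -/
theorem eq_zero_of_sum_modular_mul_G2_pow_eq_zero (hN : 1 ≤ N)
    (ha : ∀ p ∈ S, ∀ γ ∈ CongruenceSubgroup.Gamma N, a p ∣[(p.2 : ℤ)] γ = a p)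
    (h : ∀ z, ∑ p ∈ S, a p z * G2 z ^ p.1 = 0) : ∀ p ∈ S, a p = 0 := by
  suffices ∀ z, ∀ p ∈ S, a p z = 0 from fun p hp ↦ funext fun z ↦ this z p hp
  intro z
  have relation (m : ℕ) (J : ℂ) : ∑ p ∈ S, a p z * J ^ (p.2 + p.1) *
      (G2 z * J + kappa * (N * (m + 1))) ^ p.1 = 0 := by
    let P : Polynomial ℂ := ∑ p ∈ S, .C (a p z) * .X ^ (p.2 + p.1) *
      (.C (G2 z) * .X + .C (kappa * (N * (m + 1)))) ^ p.1
    have hP (x : ℂ) : P.eval x = ∑ p ∈ S, a p z * x ^ (p.2 + p.1) *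
        (G2 z * x + kappa * (N * (m + 1))) ^ p.1 := by
      simp [P, Polynomial.eval_finsetSum]
    rw [← hP, P.eq_zero_of_infinite_isRoot, Polynomial.eval_zero]
    refine (infinite_range_denom hN (Nat.cast_add_one_ne_zero m : (m + 1 : ℤ) ≠ 0) z).mono ?_
    rintro _ ⟨n, rfl⟩
    rw [Set.mem_ofPred_eq, Polynomial.IsRoot.def, hP]
    simpa [gammaElt] using sum_mul_denom_pow_mul_pow_eq_zero ha h (gammaElt_mem N (m + 1) n) z
  have he : Function.Injective fun p : ℕ × ℕ ↦ (p.2 + p.1, p.1) := by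
    rintro ⟨i, w⟩ ⟨i', w'⟩ h
    grind
  refine eq_zero_of_infinite_sum_mul_pow_mul_pow_eq_zero he Set.infinite_univ
    (t := fun J ↦ Set.range fun m : ℕ ↦ G2 z * J + kappa * (N * (m + 1))) (fun J _ ↦ ?_) ?_
  · have hN' : (N : ℂ) ≠ 0 := Nat.cast_ne_zero.mpr (by omega)
    refine Set.infinite_range_of_injective fun m m' h ↦ ?_
    simpa [kappa_ne_zero, hN'] using h
  · rintro J - _ ⟨m, rfl⟩
    exact relation m J

end Uniqueness

theorem sumCoeffs_of (L : ℕ → ℕ → (ℍ → ℂ) →ₗ[ℂ] (ℍ → ℂ)) (i w : ℕ) (a : modularTower w) :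
    sumCoeffs L (DirectSum.lof ℂ (ℕ × ℕ) (fun p ↦ modularTower p.2) (i, w) a) = L i w a := by
  rw [sumCoeffs, DirectSum.toModule_lof]
  rfl

theorem polyG2_of (i w : ℕ) (a : modularTower w) :
    polyG2 (DirectSum.lof ℂ (ℕ × ℕ) (fun p ↦ modularTower p.2) (i, w) a) = a * G2 ^ i :=
  sumCoeffs_of _ i w a

open scoped Classical in
theorem polyG2_apply (c : Coeffs) (z : ℍ) :
    polyG2 c z = ∑ p ∈ DFinsupp.support c, (c p : ℍ → ℂ) z * G2 z ^ p.1 := by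
  conv_lhs => rw [← DirectSum.sum_support_of c]
  rw [map_sum, Finset.sum_apply]
  exact Finset.sum_congr rfl fun p _ ↦ congrFun (polyG2_of p.1 p.2 (c p)) z

theorem ker_polyG2 : LinearMap.ker polyG2 = ⊥ := by
  classical
  rw [LinearMap.ker_eq_bot']
  intro c hc
  choose level one_le_level hlevel using fun p : ℕ × ℕ ↦ (c p).2
  set S := DFinsupp.support c with hS
  have hN : 1 ≤ ∏ p ∈ S, level p := Finset.one_le_prod' fun p _ ↦ one_le_level p
  have component_eq_zero := eq_zero_of_sum_modular_mul_G2_pow_eq_zero (S := S)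
    (a := fun p ↦ (c p : ℍ → ℂ)) hN ?_ ?_
  · ext p z
    by_cases hp : p ∈ S
    · simpa using congrFun (component_eq_zero p hp) z
    · rw [hS, DFinsupp.notMem_support_iff] at hp
      rw [hp]
      rfl
  · intro p hp
    exact ((isModularForm_iff hN).mp ((hlevel p).mono (Finset.dvd_prod_of_mem level hp))).2.1
  · intro z
    rw [← polyG2_apply, hc]
    rfl

theorem coeffs_polyG2 (c : Coeffs) : coeffs (polyG2 c) = c :=
  LinearMap.leftInverse_apply_of_inj ker_polyG2 c

theorem coeffs_mul_G2_pow {i w : ℕ} {a : ℍ → ℂ} (ha : a ∈ modularTower w) :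
    coeffs (a * G2 ^ i) =
      DirectSum.lof ℂ (ℕ × ℕ) (fun p ↦ modularTower p.2) (i, w) ⟨a, ha⟩ := by
  rw [← coeffs_polyG2 (DirectSum.lof ℂ (ℕ × ℕ) (fun p ↦ modularTower p.2) (i, w) ⟨a, ha⟩),
    polyG2_of]

/-! ### The structure theorem for quasimodular forms -/

/-- `f` transforms under `Γ(N)` like a quasimodular form of weight `k` and depth at most `s`, with
coefficient functions `φ_0, …, φ_s`. -/
structure HasExpansion (N k s : ℕ) (f : ℍ → ℂ) (φ : ℕ → ℍ → ℂ) : Prop where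
  mdifferentiable : ∀ j ≤ s, MDiff (φ j)
  bounded : ∀ j ≤ s, ∀ γ : SL(2, ℤ),
    IsBoundedAtImInfty (φ j ∣[(k : ℤ) - 2 * (j : ℤ)] γ)
  smul_eq : ∀ γ ∈ CongruenceSubgroup.Gamma N, ∀ z : ℍ,
    f (γ • z) = denom γ z ^ k *
      ∑ j ∈ Finset.range (s + 1), φ j z * cocycle γ z ^ j

theorem isQuasimodularForm_iff {N k s : ℕ} {f : ℍ → ℂ} :
    IsQuasimodularForm N k s f ↔ (f = 0 ∧ s = 0) ∨
      (MDiff f ∧ ∃ φ, HasExpansion N k s f φ ∧ φ s ≠ 0) := by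
  have zpow_neg_mul_eq_iff (γ : SL(2, ℤ)) (z : ℍ) (x y : ℂ) :
      denom γ z ^ (-(k : ℤ)) * x = y ↔ x = denom γ z ^ k * y := by
    rw [zpow_neg, zpow_natCast,
      inv_mul_eq_iff_eq_mul₀ (pow_ne_zero _ (denom_ne_zero γ z))]
  simp only [IsQuasimodularForm, ← ModularGroup.denom_apply, zpow_neg_mul_eq_iff]
  constructor
  · rintro (h | ⟨hf, φ, hol, bdd, top_ne, smul_eq⟩)
    · exact .inl h
    · exact .inr ⟨hf, φ, ⟨hol, bdd, smul_eq⟩, top_ne⟩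
  · rintro (h | ⟨hf, φ, ⟨hol, bdd, smul_eq⟩, top_ne⟩)
    · exact .inl h
    · exact .inr ⟨hf, φ, hol, bdd, top_ne, smul_eq⟩

theorem denom_mul (δ γ : SL(2, ℤ)) (z : ℍ) :
    denom ((δ * γ : SL(2, ℤ)) : GL (Fin 2) ℝ) z = denom δ ((γ • z : ℍ) : ℂ) * denom γ z := by
  simpa [σ] using! denom_cocycle_σ (δ : GL (Fin 2) ℝ) (γ : GL (Fin 2) ℝ) z

theorem infinite_range_cocycle {N : ℕ} (hN : 1 ≤ N) (z : ℍ) :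
    (Set.range fun n : ℤ ↦ cocycle (gammaElt N 1 n) z).Infinite := by
  have hN' : (N : ℂ) ≠ 0 := Nat.cast_ne_zero.mpr (by omega)
  have h := (infinite_range_denom hN one_ne_zero z).image (f := fun J ↦ (N : ℂ) / J)
    (Function.Injective.injOn fun x y hxy ↦ by simpa [div_eq_mul_inv, hN'] using hxy)
  rw [← Set.range_comp] at h
  simpa [cocycle, gammaElt, Function.comp_def] using h

open Polynomial in
theorem coeff_comp_C_mul_X_add_C {R : Type*} [CommSemiring R] {p : R[X]} {n : ℕ}
    (hp : p.natDegree ≤ n) (a b : R) : (p.comp (C a * X + C b)).coeff n = p.coeff n * a ^ n := by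
  rw [comp, eval₂_eq_sum_range' C (Nat.lt_succ_of_le hp), finsetSum_coeff,
    Finset.sum_range_succ, Finset.sum_eq_zero, zero_add, coeff_C_mul]
  · have h := coeff_pow_of_natDegree_le (natDegree_linear_le (a := a) (b := b)) (m := n)
    rw [mul_one] at h
    rw [h]
    simp
  · intro j hj
    rw [coeff_C_mul]
    exact mul_eq_zero_of_right _ (coeff_eq_zero_of_natDegree_lt
      ((natDegree_pow_le_of_le j natDegree_linear_le).trans_lt
        (by simpa using Finset.mem_range.mp hj)))

namespace HasExpansion

variable {N k s : ℕ} {f g : ℍ → ℂ} {φ ψ : ℕ → ℍ → ℂ}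

theorem zero_eq (h : HasExpansion N k s f φ) : f = φ 0 := by
  ext z
  have h1 := h.smul_eq 1 (one_mem _) z
  rw [Finset.sum_range_succ'] at h1
  simpa [denom_one, cocycle] using h1

theorem sub_smul (h : HasExpansion N k s f φ) (h' : HasExpansion N k s g ψ) (c : ℂ) :
    HasExpansion N k s (f - c • g) (fun j ↦ φ j - c • ψ j) where
  mdifferentiable j hj := (h.mdifferentiable j hj).sub ((h'.mdifferentiable j hj).const_smul c)
  bounded j hj γ := by
    rw [sub_eq_add_neg (φ j), SlashAction.add_slash, SlashAction.neg_slash,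
      ModularForm.SL_smul_slash]
    exact (h.bounded j hj γ).add ((h'.bounded j hj γ).smul c).neg_left
  smul_eq γ hγ z := by
    simp only [Pi.sub_apply, Pi.smul_apply, h.smul_eq γ hγ z, h'.smul_eq γ hγ z, smul_eq_mul,
      sub_mul, Finset.sum_sub_distrib, mul_sub, mul_assoc, ← Finset.mul_sum]
    ring

theorem of_top_eq_zero (h : HasExpansion N k (s + 1) f φ) (h0 : φ (s + 1) = 0) :
    HasExpansion N k s f φ where
  mdifferentiable j hj := h.mdifferentiable j (by omega)
  bounded j hj := h.bounded j (by omega)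
  smul_eq γ hγ z := by
    rw [h.smul_eq γ hγ z, Finset.sum_range_succ _ (s + 1), h0]
    simp

/-- The polynomial `P_z = ∑_j φ_j(z) X^j` attached to the coefficient functions `φ_0, …, φ_s`, so
that `f (γ z) = (cz + d)^k P_z(X(γ)(z))`. -/
def polynomial (s : ℕ) (φ : ℕ → ℍ → ℂ) (z : ℍ) : Polynomial ℂ :=
  ∑ j ∈ Finset.range (s + 1), .C (φ j z) * .X ^ j

theorem coeff_polynomial (s : ℕ) (φ : ℕ → ℍ → ℂ) (z : ℍ) : (polynomial s φ z).coeff s = φ s z := by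
  simp [polynomial, Polynomial.finsetSum_coeff, Polynomial.coeff_X_pow]

theorem natDegree_polynomial_le (s : ℕ) (φ : ℕ → ℍ → ℂ) (z : ℍ) :
    (polynomial s φ z).natDegree ≤ s :=
  Polynomial.natDegree_sum_le_of_forall_le _ _ fun j hj ↦
    (Polynomial.natDegree_C_mul_X_pow_le _ j).trans (Finset.mem_range_succ_iff.mp hj)

theorem apply_smul (h : HasExpansion N k s f φ) {γ : SL(2, ℤ)}
    (hγ : γ ∈ CongruenceSubgroup.Gamma N) (z : ℍ) :
    f (γ • z) = denom γ z ^ k * (polynomial s φ z).eval (cocycle γ z) := by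
  rw [h.smul_eq γ hγ z, polynomial, Polynomial.eval_finsetSum]
  simp

/-- Expand `f (δ γ z)` in two ways, for infinitely many `δ`. -/
theorem polynomial_smul (hN : 1 ≤ N) (h : HasExpansion N k s f φ) {γ : SL(2, ℤ)}
    (hγ : γ ∈ CongruenceSubgroup.Gamma N) (z : ℍ) :
    polynomial s φ (γ • z) = .C (denom γ z ^ k) *
      (polynomial s φ z).comp (.C (denom γ z ^ 2)⁻¹ * .X + .C (cocycle γ z)) := by
  refine Polynomial.eq_of_infinite_eval_eq _ _ ((infinite_range_cocycle hN (γ • z)).mono ?_)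
  rintro _ ⟨n, rfl⟩
  have hδ := gammaElt_mem N 1 n
  have two_expansions := h.apply_smul (mul_mem hδ hγ) z
  rw [mul_smul, h.apply_smul hδ, denom_mul, cocycle_mul, mul_pow, mul_assoc,
    mul_right_inj' (pow_ne_zero _ (denom_ne_zero _ _))] at two_expansions
  simpa [div_eq_inv_mul] using two_expansions

theorem top_slash (hN : 1 ≤ N) (h : HasExpansion N k s f φ) {γ : SL(2, ℤ)}
    (hγ : γ ∈ CongruenceSubgroup.Gamma N) : φ s ∣[(k : ℤ) - 2 * (s : ℤ)] γ = φ s := by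
  ext z
  have hJ := denom_ne_zero γ z
  have hcoeff := congrArg (Polynomial.coeff · s) (h.polynomial_smul hN hγ z)
  simp only [Polynomial.coeff_C_mul, coeff_polynomial,
    coeff_comp_C_mul_X_add_C (natDegree_polynomial_le s φ z)] at hcoeff
  rw [ModularForm.SL_slash_apply, hcoeff, neg_sub, zpow_sub₀ hJ, zpow_mul, zpow_natCast,
    zpow_natCast, zpow_ofNat, inv_pow]
  field_simp

end HasExpansion

theorem isBoundedAtImInfty_G2_pow_slash (γ : SL(2, ℤ)) (m : ℕ) :
    IsBoundedAtImInfty ((G2 ^ m) ∣[2 * (m : ℤ)] γ) := by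
  induction m with
  | zero =>
    have slash_one : ((G2 ^ 0) ∣[2 * ((0 : ℕ) : ℤ)] γ) = fun _ ↦ (1 : ℂ) := by
      ext z
      simp [ModularForm.SL_slash_apply]
    rw [slash_one]
    exact Filter.const_boundedAtFilter _ _
  | succ m ih =>
    rw [Nat.cast_succ, mul_add, mul_one, pow_succ, ModularForm.mul_slash_SL2]
    exact ih.mul (isBoundedAtImInfty_G2_slash γ)

theorem hasExpansion_mul_G2_pow {N w : ℕ} (hN : 1 ≤ N) {a : ℍ → ℂ} (ha : IsModularForm N w a)
    (i : ℕ) : HasExpansion N (w + 2 * i) i (a * G2 ^ i)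
      (fun j ↦ (kappa ^ j * (i.choose j : ℂ)) • (a * G2 ^ (i - j))) := by
  obtain ⟨hol, inv, bdd⟩ := (isModularForm_iff hN).mp ha
  refine ⟨fun j _ ↦ (hol.mul (mdifferentiable_G2.pow _)).const_smul _, fun j hj γ ↦ ?_,
    fun γ hγ z ↦ ?_⟩
  · have hw : ((w + 2 * i : ℕ) : ℤ) - 2 * (j : ℤ) = w + 2 * ((i - j : ℕ) : ℤ) := by
      push_cast [Nat.cast_sub hj]
      ring
    rw [ModularForm.SL_smul_slash, hw, ModularForm.mul_slash_SL2]
    exact ((bdd γ).mul (isBoundedAtImInfty_G2_pow_slash γ _)).const_smul_left _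
  · simp only [Pi.mul_apply, Pi.pow_apply, Pi.smul_apply, smul_eq_mul]
    rw [apply_smul_of_slash_eq (inv γ hγ) z, zpow_natCast, G2_smul, add_comm (G2 z), mul_pow,
      add_pow, pow_add, pow_mul, Finset.mul_sum, Finset.mul_sum, Finset.mul_sum]
    refine Finset.sum_congr rfl fun j _ ↦ ?_
    ring

theorem mul_G2_pow_mem_range {i w : ℕ} {a : ℍ → ℂ} (ha : a ∈ modularTower w) :
    a * G2 ^ i ∈ LinearMap.range polyG2 :=
  ⟨_, polyG2_of i w ⟨a, ha⟩⟩

/-- The top coefficient `φ_s` is a modular form of weight `k - 2s`: subtracting the multiple of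
`φ_s G₂^s` with the same top coefficient lowers the depth. -/
theorem HasExpansion.mem_range {N : ℕ} (hN : 1 ≤ N) {k s : ℕ} {f : ℍ → ℂ} {φ : ℕ → ℍ → ℂ}
    (h : HasExpansion N k s f φ) : f ∈ LinearMap.range polyG2 := by
  induction s generalizing f φ with
  | zero =>
    have hf : f ∈ modularTower k := by
      rw [h.zero_eq]
      exact ⟨N, hN, (isModularForm_iff hN).mpr ⟨h.mdifferentiable 0 le_rfl,
        fun γ hγ ↦ by simpa using h.top_slash hN hγ,
        fun γ ↦ by simpa using h.bounded 0 le_rfl γ⟩⟩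
    simpa using mul_G2_pow_mem_range (i := 0) hf
  | succ s ih =>
    have hol := h.mdifferentiable (s + 1) le_rfl
    have inv : ∀ γ ∈ CongruenceSubgroup.Gamma N, _ := fun γ hγ ↦ h.top_slash hN hγ
    have bdd := h.bounded (s + 1) le_rfl
    rcases lt_or_ge k (2 * (s + 1)) with hk | hk
    · exact ih (h.of_top_eq_zero (eq_zero_of_slash_invariant_of_neg hN (by omega) hol inv bdd))
    obtain ⟨w, rfl⟩ := Nat.exists_eq_add_of_le' hk
    have hw : ((w + 2 * (s + 1) : ℕ) : ℤ) - 2 * ((s + 1 : ℕ) : ℤ) = w := by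
      push_cast
      ring
    rw [hw] at inv bdd
    have ha : IsModularForm N w (φ (s + 1)) := (isModularForm_iff hN).mpr ⟨hol, inv, bdd⟩
    have remainder := h.sub_smul (hasExpansion_mul_G2_pow hN ha (s + 1)) (kappa ^ (s + 1))⁻¹
    have remainder_mem := ih (remainder.of_top_eq_zero (by
      simp [smul_smul, inv_mul_cancel₀ (pow_ne_zero (s + 1) kappa_ne_zero)]))
    simpa using Submodule.add_mem _ remainder_mem (Submodule.smul_mem _ (kappa ^ (s + 1))⁻¹
      (mul_G2_pow_mem_range (i := s + 1) ⟨N, hN, ha⟩))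

theorem mul_G2_pow_mem_QM {i w : ℕ} {a : ℍ → ℂ} (ha : a ∈ modularTower w) : a * G2 ^ i ∈ QM := by
  by_cases h0 : a = 0
  · simp [h0]
  obtain ⟨N, hN, ha⟩ := ha
  refine Submodule.subset_span ⟨N, w + 2 * i, i, hN, isQuasimodularForm_iff.mpr (.inr
    ⟨((isModularForm_iff hN).mp ha).1.mul (mdifferentiable_G2.pow _), _,
      hasExpansion_mul_G2_pow hN ha i, ?_⟩)⟩
  simpa [kappa_ne_zero] using h0

theorem range_polyG2_le {S : Submodule ℂ (ℍ → ℂ)}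
    (h : ∀ (i w : ℕ) (a : ℍ → ℂ), a ∈ modularTower w → a * G2 ^ i ∈ S) :
    LinearMap.range polyG2 ≤ S := by
  classical
  rintro _ ⟨c, rfl⟩
  rw [← DirectSum.sum_support_of c, map_sum]
  refine sum_mem fun p _ ↦ ?_
  rw [← DirectSum.lof_eq_of ℂ]
  exact polyG2_of p.1 p.2 (c p) ▸ h p.1 p.2 (c p) (c p).2

/-- The structure theorem of Kaneko and Zagier. -/
theorem range_polyG2 : LinearMap.range polyG2 = QM := by
  refine le_antisymm (range_polyG2_le fun _ _ _ ↦ mul_G2_pow_mem_QM) (Submodule.span_le.mpr ?_)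
  rintro f ⟨N, k, s, hN, hf⟩
  rcases isQuasimodularForm_iff.mp hf with ⟨rfl, -⟩ | ⟨-, φ, h, -⟩
  · exact zero_mem _
  · exact h.mem_range hN

theorem QM_le {S : Submodule ℂ (ℍ → ℂ)}
    (h : ∀ (i w : ℕ) (a : ℍ → ℂ), a ∈ modularTower w → a * G2 ^ i ∈ S) : QM ≤ S :=
  range_polyG2 ▸ range_polyG2_le h

theorem eq_on_QM {V : Type*} [AddCommMonoid V] [Module ℂ V] {L L' : (ℍ → ℂ) →ₗ[ℂ] V}
    (h : ∀ (i w : ℕ) (a : ℍ → ℂ), a ∈ modularTower w → L (a * G2 ^ i) = L' (a * G2 ^ i))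
    {f : ℍ → ℂ} (hf : f ∈ QM) : L f = L' f :=
  QM_le (S := LinearMap.eqLocus L L') h hf

theorem mem_QM_of_mem_modularTower {w : ℕ} {a : ℍ → ℂ} (ha : a ∈ modularTower w) : a ∈ QM := by
  simpa using mul_G2_pow_mem_QM (i := 0) ha

theorem mul_mem_QM {f g : ℍ → ℂ} (hf : f ∈ QM) (hg : g ∈ QM) : f * g ∈ QM := by
  refine QM_le (S := QM.comap (LinearMap.mulRight ℂ g)) (fun i w a ha ↦ ?_) hf
  refine QM_le (S := QM.comap (LinearMap.mulLeft ℂ (a * G2 ^ i))) (fun j v b hb ↦ ?_) hg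
  rw [Submodule.mem_comap, LinearMap.mulLeft_apply, mul_mul_mul_comm, ← pow_add]
  exact mul_G2_pow_mem_QM (mul_mem_modularTower ha hb)

/-! ### The derivation with respect to `G₂` -/

/-- The derivation `∂ = ∂/∂G₂` of the polynomial ring `QM = M[G₂]`; like `coeffs`, it is defined on
all functions, but meaningful on `QM` only. -/
def derivG2 : (ℍ → ℂ) →ₗ[ℂ] (ℍ → ℂ) :=
  sumCoeffs (fun i _ ↦ (i : ℂ) • LinearMap.mulRight ℂ (G2 ^ (i - 1))) ∘ₗ coeffs

theorem derivG2_mul_G2_pow {i w : ℕ} {a : ℍ → ℂ} (ha : a ∈ modularTower w) :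
    derivG2 (a * G2 ^ i) = (i : ℂ) • (a * G2 ^ (i - 1)) := by
  rw [derivG2, LinearMap.comp_apply, coeffs_mul_G2_pow ha, sumCoeffs_of]
  rfl

theorem derivG2_of_mem_modularTower {w : ℕ} {a : ℍ → ℂ} (ha : a ∈ modularTower w) :
    derivG2 a = 0 := by
  simpa using derivG2_mul_G2_pow (i := 0) ha

theorem derivG2_mem_QM {f : ℍ → ℂ} (hf : f ∈ QM) : derivG2 f ∈ QM :=
  QM_le (S := QM.comap derivG2)
    (fun _ _ _ ha ↦ by
      rw [Submodule.mem_comap, derivG2_mul_G2_pow ha]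
      exact QM.smul_mem _ (mul_G2_pow_mem_QM ha)) hf

theorem smul_pow_mul_pow_sub_one (f : ℍ → ℂ) (i j : ℕ) :
    (i : ℂ) • (f ^ (i - 1) * f ^ j) = (i : ℂ) • f ^ (i + j - 1) := by
  rcases i with _ | i
  · simp
  · rw [← pow_add, show i + 1 - 1 + j = i + 1 + j - 1 by omega]

theorem derivG2_mul {f g : ℍ → ℂ} (hf : f ∈ QM) (hg : g ∈ QM) :
    derivG2 (f * g) = f * derivG2 g + derivG2 f * g := by
  refine eq_on_QM (L := derivG2 ∘ₗ LinearMap.mulRight ℂ g)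
    (L' := LinearMap.mulRight ℂ (derivG2 g) + LinearMap.mulRight ℂ g ∘ₗ derivG2)
    (fun i w a ha ↦ ?_) hf
  refine eq_on_QM (L := derivG2 ∘ₗ LinearMap.mulLeft ℂ (a * G2 ^ i))
    (L' := LinearMap.mulLeft ℂ (a * G2 ^ i) ∘ₗ derivG2 +
      LinearMap.mulLeft ℂ (derivG2 (a * G2 ^ i))) (fun j v b hb ↦ ?_) hg
  have hi := smul_pow_mul_pow_sub_one G2 i j
  have hj := smul_pow_mul_pow_sub_one G2 j i
  simp only [LinearMap.comp_apply, LinearMap.add_apply, LinearMap.mulLeft_apply]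
  rw [mul_mul_mul_comm, ← pow_add, derivG2_mul_G2_pow (mul_mem_modularTower ha hb),
    derivG2_mul_G2_pow ha, derivG2_mul_G2_pow hb]
  rw [add_comm j i] at hj
  simp only [Algebra.smul_def, map_natCast] at hi hj ⊢
  push_cast
  linear_combination (-(a * b)) * hi - a * b * hj

theorem dslash_mul_G2_pow {i w : ℕ} {a : ℍ → ℂ} (ha : a ∈ modularTower w) (α : GQ) :
    dslash α (a * G2 ^ i) = slash w α a * G2 ^ i := by
  rw [dslash, LinearMap.comp_apply, coeffs_mul_G2_pow ha, sumCoeffs_of]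
  rfl

theorem dslash_of_mem_modularTower {w : ℕ} {a : ℍ → ℂ} (ha : a ∈ modularTower w) (α : GQ) :
    dslash α a = slash w α a := by
  simpa using dslash_mul_G2_pow (i := 0) ha α

theorem dslash_mul (α : GQ) {f g : ℍ → ℂ} (hf : f ∈ QM) (hg : g ∈ QM) :
    dslash α (f * g) = dslash α f * dslash α g := by
  refine eq_on_QM (L := dslash α ∘ₗ LinearMap.mulRight ℂ g)
    (L' := LinearMap.mulRight ℂ (dslash α g) ∘ₗ dslash α) (fun i w a ha ↦ ?_) hf
  refine eq_on_QM (L := dslash α ∘ₗ LinearMap.mulLeft ℂ (a * G2 ^ i))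
    (L' := LinearMap.mulLeft ℂ (dslash α (a * G2 ^ i)) ∘ₗ dslash α) (fun j v b hb ↦ ?_) hg
  simp only [LinearMap.comp_apply, LinearMap.mulLeft_apply]
  rw [mul_mul_mul_comm, ← pow_add, dslash_mul_G2_pow (mul_mem_modularTower ha hb),
    dslash_mul_G2_pow ha, dslash_mul_G2_pow hb, slash_mul, pow_add, mul_mul_mul_comm]

theorem dslash_derivG2 (α : GQ) {f : ℍ → ℂ} (hf : f ∈ QM) :
    dslash α (derivG2 f) = derivG2 (dslash α f) :=
  eq_on_QM (L := dslash α ∘ₗ derivG2) (L' := derivG2 ∘ₗ dslash α)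
    (fun i w a ha ↦ by
      rw [LinearMap.comp_apply, LinearMap.comp_apply, derivG2_mul_G2_pow ha, map_smul,
        dslash_mul_G2_pow ha, dslash_mul_G2_pow ha,
        derivG2_mul_G2_pow (slash_mem_modularTower α ha)]) hf

/-! ### `D` and `T_k^l` as vector fields -/

/-- The vector field `p ∂/∂G₂`, as an operator on `QM`. -/
def vectorField (p : ℍ → ℂ) : (ℍ → ℂ) →ₗ[ℂ] (ℍ → ℂ) := LinearMap.mulLeft ℂ p ∘ₗ derivG2

theorem vectorField_apply (p f : ℍ → ℂ) : vectorField p f = p * derivG2 f := rfl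

theorem vectorField_mem_QM {p f : ℍ → ℂ} (hp : p ∈ QM) (hf : f ∈ QM) : vectorField p f ∈ QM :=
  mul_mem_QM hp (derivG2_mem_QM hf)

theorem vectorField_comm {p q f : ℍ → ℂ} (hp : p ∈ QM) (hq : q ∈ QM) (hf : f ∈ QM) :
    vectorField p (vectorField q f) - vectorField q (vectorField p f) =
      vectorField (p * derivG2 q - q * derivG2 p) f := by
  have hf' := derivG2_mem_QM hf
  simp only [vectorField_apply, derivG2_mul hp hf', derivG2_mul hq hf']
  ring

theorem vectorField_modular_mul {w : ℕ} {a f : ℍ → ℂ} (p : ℍ → ℂ) (ha : a ∈ modularTower w)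
    (hf : f ∈ QM) : vectorField p (a * f) = a * vectorField p f := by
  rw [vectorField_apply, derivG2_mul (mem_QM_of_mem_modularTower ha) hf,
    derivG2_of_mem_modularTower ha, zero_mul, add_zero, vectorField_apply, mul_left_comm]

theorem dslash_vectorField {α : GQ} {p f : ℍ → ℂ} (hp : p ∈ QM) (hα : dslash α p = p)
    (hf : f ∈ QM) : dslash α (vectorField p f) = vectorField p (dslash α f) := by
  rw [vectorField_apply, dslash_mul α hp (derivG2_mem_QM hf), hα, dslash_derivG2 α hf,
    vectorField_apply]

/-- The component `G₄^l G₂^{k-1}` of the vector field `T_k^l`, for `k ≥ 1`. -/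
def componentT (k l : ℕ) : ℍ → ℂ := G4 ^ l * G2 ^ (k - 1)

/-- The component `G₂²/2 - 5 G₄/24` of the vector field `D`: by Ramanujan's identity it is
`-(8πi)⁻¹ G₂'`. -/
def componentD : ℍ → ℂ := (1 / 2 : ℂ) • componentT 3 0 - (5 / 24 : ℂ) • componentT 1 1

theorem comp_sumCoeffs (T : (ℍ → ℂ) →ₗ[ℂ] (ℍ → ℂ)) (L : ℕ → ℕ → (ℍ → ℂ) →ₗ[ℂ] (ℍ → ℂ)) :
    T ∘ₗ sumCoeffs L = sumCoeffs fun i w ↦ T ∘ₗ L i w :=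
  DirectSum.linearMap_ext ℂ fun ⟨i, w⟩ ↦ LinearMap.ext fun ⟨a, ha⟩ ↦ by
    exact (congrArg T (sumCoeffs_of L i w ⟨a, ha⟩)).trans
      (sumCoeffs_of (fun i w ↦ T ∘ₗ L i w) i w ⟨a, ha⟩).symm

theorem opT_eq {k : ℕ} (hk : 1 ≤ k) (l : ℕ) (f : ℍ → ℂ) :
    opT k l f = vectorField (componentT k l) f := by
  have opW_eq : opW k = LinearMap.mulLeft ℂ (G2 ^ (k - 1)) ∘ₗ derivG2 := by
    rw [opW, derivG2, ← LinearMap.comp_assoc, comp_sumCoeffs]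
    refine congrArg (sumCoeffs · ∘ₗ coeffs) (funext₂ fun i _ ↦ LinearMap.ext fun a ↦ ?_)
    have h := smul_pow_mul_pow_sub_one G2 i (k - 1)
    rw [← Nat.add_sub_assoc hk, Nat.sub_sub] at h
    simp only [LinearMap.comp_apply, LinearMap.smul_apply, LinearMap.mulRight_apply,
      LinearMap.mulLeft_apply]
    rw [mul_smul_comm, mul_left_comm, mul_comm (G2 ^ (k - 1)), ← mul_smul_comm, ← mul_smul_comm, h]
  rw [opT, opW_eq, componentT, vectorField_apply, mul_assoc]
  rfl

theorem G2'_eq_smul_componentD :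
    G2' = (-(8 * (Real.pi : ℂ) * Complex.I)) • componentD := by
  rw [G2'_eq, componentD, componentT, componentT]
  ext z
  simp only [Pi.smul_apply, Pi.sub_apply, Pi.mul_apply, Pi.pow_apply, smul_eq_mul]
  ring

theorem opD_eq (f : ℍ → ℂ) : opD f = vectorField componentD f := by
  have opD_eq_smul : opD =
      (-(1 / (8 * (Real.pi : ℂ) * Complex.I))) • (LinearMap.mulLeft ℂ G2' ∘ₗ derivG2) := by
    rw [opD, derivG2, ← LinearMap.comp_assoc, comp_sumCoeffs]
    refine congrArg (_ • sumCoeffs · ∘ₗ coeffs) (funext₂ fun i _ ↦ LinearMap.ext fun a ↦ ?_)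
    simp only [LinearMap.comp_apply, LinearMap.smul_apply, LinearMap.mulRight_apply,
      LinearMap.mulLeft_apply]
    rw [mul_smul_comm, ← mul_assoc, mul_comm G2']
  have hc : 8 * (Real.pi : ℂ) * Complex.I ≠ 0 := by simp [Real.pi_ne_zero]
  rw [opD_eq_smul, LinearMap.smul_apply, LinearMap.comp_apply, LinearMap.mulLeft_apply,
    G2'_eq_smul_componentD, smul_mul_assoc, smul_smul, neg_mul_neg, one_div_mul_cancel hc, one_smul,
    vectorField_apply]

theorem componentT_mem_QM (k l : ℕ) : componentT k l ∈ QM :=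
  mul_G2_pow_mem_QM (pow_mem_modularTower G4_mem_modularTower l)

theorem componentD_mem_QM : componentD ∈ QM :=
  QM.sub_mem (QM.smul_mem _ (componentT_mem_QM 3 0)) (QM.smul_mem _ (componentT_mem_QM 1 1))

theorem dslash_componentT (γ : SL(2, ℤ)) (k l : ℕ) :
    dslash (toGQ γ) (componentT k l) = componentT k l := by
  rw [componentT, dslash_mul_G2_pow (pow_mem_modularTower G4_mem_modularTower l), G4_pow_slash]

theorem dslash_componentD (γ : SL(2, ℤ)) : dslash (toGQ γ) componentD = componentD := by
  rw [componentD, map_sub, map_smul, map_smul, dslash_componentT, dslash_componentT]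

theorem derivG2_componentT (k l : ℕ) :
    derivG2 (componentT (k + 1) l) = (k : ℂ) • componentT k l :=
  derivG2_mul_G2_pow (pow_mem_modularTower G4_mem_modularTower l)

theorem componentT_mul (k l k' l' : ℕ) :
    componentT (k + 1) l * componentT (k' + 1) l' = componentT (k + k' + 1) (l + l') := by
  simp only [componentT, Nat.add_sub_cancel, pow_add]
  ring

theorem componentT_mul_derivG2 (k l k' l' : ℕ) :
    componentT (k + 1) l * derivG2 (componentT (k' + 1) l') =
      (k' : ℂ) • componentT (k + k') (l + l') := by
  rcases k' with _ | k'
  · rw [derivG2_componentT, Nat.cast_zero, zero_smul, zero_smul, mul_zero]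
  · rw [derivG2_componentT, mul_smul_comm, componentT_mul, add_assoc]

theorem bracket_componentT (k l k' l' : ℕ) :
    componentT (k + 1) l * derivG2 (componentT (k' + 1) l') -
        componentT (k' + 1) l' * derivG2 (componentT (k + 1) l) =
      ((k' : ℂ) - k) • componentT (k + k') (l + l') := by
  rw [componentT_mul_derivG2, componentT_mul_derivG2, add_comm k' k, add_comm l' l, sub_smul]

theorem bracket_componentT_componentD (k l : ℕ) :
    componentT (k + 1) l * derivG2 componentD - componentD * derivG2 (componentT (k + 1) l) =
      (5 / 24 * k : ℂ) • componentT k (l + 1) -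
        (1 / 2 * (k - 2) : ℂ) • componentT (k + 2) l := by
  have h3 := bracket_componentT k l 2 0
  have h1 := bracket_componentT k l 0 1
  rw [componentD, map_sub, map_smul, map_smul, mul_sub, sub_mul, mul_smul_comm, mul_smul_comm,
    smul_mul_assoc, smul_mul_assoc]
  simp only [Nat.cast_zero, Nat.cast_ofNat, zero_add, add_zero, Nat.reduceAdd] at h1 h3
  linear_combination (norm := module) (1 / 2 : ℂ) • h3 - (5 / 24 : ℂ) • h1

theorem vectorField_sub_smul (c d : ℂ) (p q f : ℍ → ℂ) :
    vectorField (c • p - d • q) f = c • vectorField p f - d • vectorField q f := by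
  simp only [vectorField_apply, sub_mul, smul_mul_assoc]

theorem vectorField_componentT_comm {k k' : ℕ} (hk : 1 ≤ k) (hk' : 1 ≤ k') (l l' : ℕ)
    {f : ℍ → ℂ} (hf : f ∈ QM) :
    vectorField (componentT k l) (vectorField (componentT k' l') f) -
        vectorField (componentT k' l') (vectorField (componentT k l) f) =
      ((k' : ℂ) - k) • vectorField (componentT (k + k' - 2) (l + l')) f := by
  obtain ⟨k, rfl⟩ := Nat.exists_eq_add_of_le' hk
  obtain ⟨k', rfl⟩ := Nat.exists_eq_add_of_le' hk'
  rw [vectorField_comm (componentT_mem_QM _ _) (componentT_mem_QM _ _) hf, bracket_componentT,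
    show k + 1 + (k' + 1) - 2 = k + k' by omega, vectorField_apply, smul_mul_assoc,
    Nat.cast_add, Nat.cast_add, add_sub_add_right_eq_sub, vectorField_apply]

theorem vectorField_componentT_componentD_comm {k : ℕ} (hk : 1 ≤ k) (l : ℕ)
    {f : ℍ → ℂ} (hf : f ∈ QM) :
    vectorField (componentT k l) (vectorField componentD f) -
        vectorField componentD (vectorField (componentT k l) f) =
      (5 / 24 * ((k : ℂ) - 1)) • vectorField (componentT (k - 1) (l + 1)) f -
        (1 / 2 * ((k : ℂ) - 3)) • vectorField (componentT (k + 1) l) f := by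
  obtain ⟨k, rfl⟩ := Nat.exists_eq_add_of_le' hk
  rw [vectorField_comm (componentT_mem_QM _ _) componentD_mem_QM hf, bracket_componentT_componentD,
    vectorField_sub_smul, Nat.add_sub_cancel]
  congr 2 <;> push_cast <;> ring

/-! ### The action on quasimodular Hecke operators -/

/-- Families of operators on `QM`, indexed by `GL₂⁺(ℚ)`, that are compatible with `Γ(N)` in such a
way that `F_α ↦ Φ_α(F_α)` preserves `Q(Γ(N))`. -/
structure IsEquivariantFamily (N : ℕ) (Φ : GQ → (ℍ → ℂ) →ₗ[ℂ] (ℍ → ℂ)) : Prop where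
  mem_QM : ∀ α, ∀ f ∈ QM, Φ α f ∈ QM
  mul_left : ∀ γ ∈ levelQ N, ∀ α, Φ (γ * α) = Φ α
  dslash_apply : ∀ γ ∈ levelQ N, ∀ α, ∀ f ∈ QM, dslash γ (Φ α f) = Φ (α * γ) (dslash γ f)

theorem IsEquivariantFamily.apply_mem_HeckeOps {N : ℕ} {Φ : GQ → (ℍ → ℂ) →ₗ[ℂ] (ℍ → ℂ)}
    (hΦ : IsEquivariantFamily N Φ) {F : GQ → ℍ → ℂ} (hF : F ∈ HeckeOps N) :
    (fun α ↦ Φ α (F α)) ∈ HeckeOps N := by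
  obtain ⟨hmem, hleft, hsupp, hright⟩ := hF
  refine ⟨fun α ↦ hΦ.mem_QM α _ (hmem α), fun γ hγ α ↦ ?_,
    hsupp.subset (Set.image_mono fun α hα h0 ↦ hα ?_), fun γ hγ α ↦ ?_⟩
  · simp only [hΦ.mul_left γ hγ, hleft γ hγ]
  · simp only [h0, map_zero]
  · simp only [hright γ hγ, hΦ.dslash_apply γ hγ α _ (hmem α)]

/-- The endomorphism `(F_α) ↦ (Φ_α(F_α))` of `Q(Γ(N))`. -/
def IsEquivariantFamily.toEnd {N : ℕ} {Φ : GQ → (ℍ → ℂ) →ₗ[ℂ] (ℍ → ℂ)}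
    (hΦ : IsEquivariantFamily N Φ) : Module.End ℂ (HeckeOps N) where
  toFun F := ⟨fun α ↦ Φ α (F.1 α), hΦ.apply_mem_HeckeOps F.2⟩
  map_add' F G := Subtype.ext (funext fun α ↦ map_add (Φ α) (F.1 α) (G.1 α))
  map_smul' c F := Subtype.ext (funext fun α ↦ map_smul (Φ α) c (F.1 α))

theorem isEquivariantFamily_vectorField {N : ℕ} {p : ℍ → ℂ} (hp : p ∈ QM)
    (hp_inv : ∀ γ : SL(2, ℤ), dslash (toGQ γ) p = p) :
    IsEquivariantFamily N fun _ ↦ vectorField p where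
  mem_QM _ _ hf := vectorField_mem_QM hp hf
  mul_left _ _ _ := rfl
  dslash_apply := by
    rintro _ ⟨γ, -, rfl⟩ _ f hf
    exact dslash_vectorField hp (hp_inv γ) hf

theorem isEquivariantFamily_mulLeft_nu (N m : ℕ) :
    IsEquivariantFamily N fun α ↦ LinearMap.mulLeft ℂ (nu m α) where
  mem_QM α _ hf := mul_mem_QM (mem_QM_of_mem_modularTower (nu_mem_modularTower m α)) hf
  mul_left := by
    rintro _ ⟨γ, -, rfl⟩ α
    rw [nu_mul_left]
  dslash_apply := by
    rintro _ ⟨γ, -, rfl⟩ α f hf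
    have hν := nu_mem_modularTower m α
    simp only [LinearMap.mulLeft_apply]
    rw [dslash_mul _ (mem_QM_of_mem_modularTower hν) hf, dslash_of_mem_modularTower hν,
      nu_mul_right]

/-- The family of operators through which a symbol acts. -/
def symbolOp : Symbols → GQ → (ℍ → ℂ) →ₗ[ℂ] (ℍ → ℂ)
  | .D, _ => vectorField componentD
  | .T k l, _ => vectorField (componentT k l)
  | .phi m, α => LinearMap.mulLeft ℂ (nu m α)

theorem isEquivariantFamily_symbolOp (N : ℕ) : ∀ x, IsEquivariantFamily N (symbolOp x)
  | .D => isEquivariantFamily_vectorField componentD_mem_QM dslash_componentD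
  | .T k l => isEquivariantFamily_vectorField (componentT_mem_QM k l)
      fun γ ↦ dslash_componentT γ k l
  | .phi m => isEquivariantFamily_mulLeft_nu N m

/-- The endomorphism of `Q(Γ(N))` attached to a symbol. -/
def symbolEnd (N : ℕ) (x : Symbols) : Module.End ℂ (HeckeOps N) :=
  (isEquivariantFamily_symbolOp N x).toEnd

theorem symbolEnd_lie_apply (N : ℕ) (x y : Symbols) (F : HeckeOps N) (α : GQ) :
    (⁅symbolEnd N x, symbolEnd N y⁆ F).1 α =
      symbolOp x α (symbolOp y α (F.1 α)) - symbolOp y α (symbolOp x α (F.1 α)) :=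
  rfl

/-- The action of the free Lie algebra on `Q(Γ(N))`. -/
def freeAction (N : ℕ) : FreeL →ₗ⁅ℂ⁆ Module.End ℂ (HeckeOps N) :=
  FreeLieAlgebra.lift ℂ (symbolEnd N)

theorem freeAction_freeT (N : ℕ) {k : ℕ} (hk : 0 < k) (l : ℕ) :
    freeAction N (freeT k l) = symbolEnd N (.T ⟨k, hk⟩ l) := by
  rw [freeT, dif_pos hk, freeAction, FreeLieAlgebra.lift_of_apply]

theorem freeAction_freeD (N : ℕ) : freeAction N freeD = symbolEnd N .D := by
  rw [freeD, freeAction, FreeLieAlgebra.lift_of_apply]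

theorem freeAction_freePhi (N : ℕ) (m : ℕ+) : freeAction N (freePhi m) = symbolEnd N (.phi m) := by
  rw [freePhi, freeAction, FreeLieAlgebra.lift_of_apply]

theorem smul_freeAction_freeT_apply {N k : ℕ} (l : ℕ) {c : ℂ} (hc : k = 0 → c = 0)
    (F : HeckeOps N) (α : GQ) :
    (c • freeAction N (freeT k l) F).1 α = c • vectorField (componentT k l) (F.1 α) := by
  rcases Nat.eq_zero_or_pos k with rfl | hk
  · rw [hc rfl, zero_smul, zero_smul]
    rfl
  · rw [freeAction_freeT N hk]
    rfl

theorem freeAction_relator (N : ℕ) {x : FreeL} (hx : IsRelator x) : freeAction N x = 0 := by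
  refine LinearMap.ext fun F ↦ Subtype.ext (funext fun α ↦ ?_)
  have hF : F.1 α ∈ QM := F.2.1 α
  cases hx with
  | TT k k' l l' hk hk' =>
    rw [map_sub, LieHom.map_lie, map_smul, freeAction_freeT N hk, freeAction_freeT N hk']
    refine sub_eq_zero.mpr ((symbolEnd_lie_apply N _ _ F α).trans ?_)
    refine Eq.trans ?_ (smul_freeAction_freeT_apply _ ?_ F α).symm
    · exact vectorField_componentT_comm hk hk' l l' hF
    · intro h
      rw [show k' = k by omega, sub_self]
  | Dphi m =>
    rw [LieHom.map_lie, freeAction_freeD, freeAction_freePhi, symbolEnd_lie_apply]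
    exact sub_eq_zero.mpr (vectorField_modular_mul _ (nu_mem_modularTower m α) hF)
  | Tphi k l m hk =>
    rw [LieHom.map_lie, freeAction_freeT N hk, freeAction_freePhi, symbolEnd_lie_apply]
    exact sub_eq_zero.mpr (vectorField_modular_mul _ (nu_mem_modularTower m α) hF)
  | phiphi m m' =>
    rw [LieHom.map_lie, freeAction_freePhi, freeAction_freePhi, symbolEnd_lie_apply]
    exact sub_eq_zero.mpr (mul_left_comm _ _ _)
  | TD k l hk =>
    rw [map_sub, map_sub, LieHom.map_lie, map_smul, map_smul, freeAction_freeT N hk,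
      freeAction_freeD]
    refine sub_eq_zero.mpr ((symbolEnd_lie_apply N _ _ F α).trans ?_)
    refine Eq.trans ?_ (congrArg₂ (· - ·) (smul_freeAction_freeT_apply _ ?_ F α)
      (smul_freeAction_freeT_apply _ ?_ F α)).symm
    · exact vectorField_componentT_componentD_comm hk l hF
    · intro h
      rw [show k = 1 by omega, Nat.cast_one, sub_self, mul_zero]
    · omega

theorem relIdeal_le_ker (N : ℕ) : relIdeal ≤ (freeAction N).ker :=
  LieSubmodule.lieSpan_le.mpr fun _ hx ↦ LieHom.mem_ker.mpr (freeAction_relator N hx)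

/-- The action of the Lie algebra `L` on `Q(Γ(N))`. -/
def action (N : ℕ) : LieL →ₗ⁅ℂ⁆ Module.End ℂ (HeckeOps N) where
  toLinearMap := relIdeal.toSubmodule.liftQ (freeAction N : FreeL →ₗ[ℂ] _)
    fun _ hx ↦ LinearMap.mem_ker.mpr (LieHom.mem_ker.mp (relIdeal_le_ker N hx))
  map_lie' {x y} := by
    obtain ⟨x, rfl⟩ := LieSubmodule.Quotient.surjective_mk' relIdeal x
    obtain ⟨y, rfl⟩ := LieSubmodule.Quotient.surjective_mk' relIdeal y
    exact LieHom.map_lie (freeAction N) x y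

theorem action_gen_apply (N : ℕ) (x : Symbols) (F : HeckeOps N) (α : GQ) :
    (action N (gen x) F).1 α = symbolOp x α (F.1 α) :=
  congrArg (fun φ : Module.End ℂ (HeckeOps N) ↦ (φ F).1 α)
    (FreeLieAlgebra.lift_of_apply (R := ℂ) (symbolEnd N) x)

end

end QuasimodularHecke

theorem mainTheorem12 (N : ℕ) (hN : 1 ≤ N) :
    ∃ ρ : QuasimodularHecke.LieL →ₗ⁅ℂ⁆ Module.End ℂ (QuasimodularHecke.HeckeOps N),
      (∀ (F : QuasimodularHecke.HeckeOps N) (α : QuasimodularHecke.GQ),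
        (ρ (QuasimodularHecke.gen QuasimodularHecke.Symbols.D) F).1 α =
          QuasimodularHecke.opD (F.1 α)) ∧
      (∀ (k : ℕ+) (l : ℕ) (F : QuasimodularHecke.HeckeOps N) (α : QuasimodularHecke.GQ),
        (ρ (QuasimodularHecke.gen (QuasimodularHecke.Symbols.T k l)) F).1 α =
          QuasimodularHecke.opT k l (F.1 α)) ∧
      (∀ (m : ℕ+) (F : QuasimodularHecke.HeckeOps N) (α : QuasimodularHecke.GQ),
        (ρ (QuasimodularHecke.gen (QuasimodularHecke.Symbols.phi m)) F).1 α =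
          QuasimodularHecke.nu m α * F.1 α) := by
  refine ⟨QuasimodularHecke.action N, fun F α ↦ ?_, fun k l F α ↦ ?_, fun m F α ↦ ?_⟩
  · rw [QuasimodularHecke.action_gen_apply, QuasimodularHecke.opD_eq]
    rfl
  · rw [QuasimodularHecke.action_gen_apply, QuasimodularHecke.opT_eq k.pos]
    rfl
  · rw [QuasimodularHecke.action_gen_apply]
    rfl
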